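/- Let $\mathbb G=(\mathbb R^n,\circ,\delta_\lambda)$ be a stratified Lie group (homogeneous Carnot group): $\circ$ is a smooth (Lie) group law on $\mathbb R^n$ with identity $0$; the coordinates are grouped into strata and the dilations $\delta_\lambda$ ($\lambda>0$), which multiply each coordinate of the $l$-th stratum by $\lambda^l$, are automorphisms; and, if $X_1,\dots,X_N$ denote the left-invariant vector fields with $X_i(0)=\partial/\partial x_i$, one for each coordinate $x_i$ of the first stratum, the iterated Lie brackets of $X_1,\dots,X_N$ span $\mathbb R^n$ at every point. Let $\Omega\subsetneq\mathbb R^n$ be a nonempty open set that is convex in the Euclidean sense, and write $d(x)=\operatorname{dist}(x,\partial\Omega)$ for the Euclidean distance. For every $x\in\Omega$ let $\nu(x)$ be the inward unit normal to $\partial\Omega$ at a point $\hat x\in\partial\Omega$ with $d(x)=|x-\hat x|$. Let $1<p<\infty$, put $$\mathcal W_p(x)=\Big(\sum_{i=1}^N|\langle X_i(x),\nu(x)\rangle|^p\Big)^{1/p},$$ and let $X_i\langle X_i(x),\nu\rangle$ denote the derivative at $x$, along $X_i$, of the function $y\mapsto\langle X_i(y),\nu\rangle$ with the vector $\nu=\nu(x)$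 held fixed. Let $\beta<0$ and $u\in C_0^\infty(\Omega)$ (real- or complex-valued), and put $$T_i(x)=\Big(\frac{|\langle X_i(x),\nu\rangle|}{d(x)}\Big)^{p-2}\,\frac{X_i\langle X_i(x),\nu\rangle}{d(x)}\,|u(x)|^p,\qquad i=1,\dots,N,$$ where $0^{p-2}$ is read as $0$ if $p<2$ and as $1$ if $p=2$. Then $\sum_i|X_iu|^p$ and $\mathcal W_p^p\,d^{-p}\,|u|^p$ are integrable over $\Omega$, and $$\int_\Omega\sum_{i=1}^N|X_iu|^p\,dx\ \ge\ -(p-1)\big(|\beta|^{\frac p{p-1}}+\beta\big)\int_\Omega\frac{\mathcal W_p(x)^p}{d(x)^p}\,|u|^p\,dx+\beta(p-1)\int_\Omega\sum_{i=1}^N\Big(\frac{|\langle X_i(x),\nu\rangle|}{d(x)}\Big)^{p-2}\frac{X_i\langle X_i(x),\nu\rangle}{d(x)}\,|u|^p\,dx .$$ If $p\ge2$, all $T_i$ are integrable over $\Omega$ and the inequality holds without any further condition. If $1<p<2$, the inequality is asserted whenever the positive parts $\max(T_i,0)$ are integrable over $\Omega$; the $T_i$ themselves are then integrable as well. (If the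 positive part of some $T_i$ has infinite integral, then, as $\beta<0$, the integral of $\beta T_i$ is $-\infty$ or undefined, and nothing is asserted.) -/

import Mathlib

open scoped ContDiff

/-- The dilation `δ_t(x) = (t ^ w₁ x₁, …, t ^ wₙ xₙ)` of `ℝⁿ` with weights `w`. -/
noncomputable def weightedDilation {n : ℕ} (w : Fin n → ℕ) (t : ℝ)
    (x : EuclideanSpace ℝ (Fin n)) : EuclideanSpace ℝ (Fin n) :=
  WithLp.toLp 2 (fun j => t ^ w j * x j)

/-- For a group law `m` on `ℝⁿ` with identity `0`, the left-invariant vector field whose value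
at `0` is the `j`-th coordinate vector, i.e. the differential of `y ↦ m x y` at `0` applied to
that vector. -/
noncomputable def jacobianField {n : ℕ}
    (m : EuclideanSpace ℝ (Fin n) → EuclideanSpace ℝ (Fin n) → EuclideanSpace ℝ (Fin n))
    (j : Fin n) (x : EuclideanSpace ℝ (Fin n)) : EuclideanSpace ℝ (Fin n) :=
  fderiv ℝ (m x) 0 (EuclideanSpace.single j 1)

/-- The iterated Lie brackets of the vector fields in `S`. -/
inductive IteratedBracket {E : Type} [NormedAddCommGroup E] [NormedSpace ℝ E]
    (S : Set (E → E)) : (E → E) → Prop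
  | generator (V : E → E) (hV : V ∈ S) : IteratedBracket S V
  | bracket (V W : E → E) (hV : IteratedBracket S V) (hW : IteratedBracket S W) :
      IteratedBracket S (VectorField.lieBracket ℝ V W)

/-- A stratified Lie group (homogeneous Carnot group) `(ℝⁿ, ∘, δ_t)`: a Lie group structure on
`ℝⁿ` with identity `0`, for which the dilations `δ_t`, `t > 0`, are automorphisms, and such that
the Jacobian generators of the first stratum satisfy the rank condition. The coordinates of
weight `l` are those of the `l`-th stratum. -/
structure StratifiedGroup (n : ℕ) where
  /-- the stratum in which each coordinate lies -/
  weight : Fin n → ℕ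
  weight_pos : ∀ j, 1 ≤ weight j
  weight_mono : Monotone weight
  /-- the group law -/
  op : EuclideanSpace ℝ (Fin n) → EuclideanSpace ℝ (Fin n) → EuclideanSpace ℝ (Fin n)
  /-- the group inverse -/
  inv : EuclideanSpace ℝ (Fin n) → EuclideanSpace ℝ (Fin n)
  op_assoc : ∀ x y z, op (op x y) z = op x (op y z)
  zero_op : ∀ x, op 0 x = x
  op_zero : ∀ x, op x 0 = x
  inv_op : ∀ x, op (inv x) x = 0
  op_inv : ∀ x, op x (inv x) = 0
  contDiff_op : ContDiff ℝ ∞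
    (fun q : EuclideanSpace ℝ (Fin n) × EuclideanSpace ℝ (Fin n) => op q.1 q.2)
  contDiff_inv : ContDiff ℝ ∞ inv
  dilation_op : ∀ t : ℝ, 0 < t → ∀ x y,
    weightedDilation weight t (op x y) =
      op (weightedDilation weight t x) (weightedDilation weight t y)
  rank_condition : ∀ x, Submodule.span ℝ
    {v | ∃ V, IteratedBracket {Y | ∃ j, weight j = 1 ∧ Y = jacobianField op j} V ∧ V x = v} = ⊤

namespace StratifiedGroup

variable {n : ℕ} (G : StratifiedGroup n)

/-- The indices `1, …, N` of the coordinates of the first stratum. -/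
abbrev Horizontal : Type := {j : Fin n // G.weight j = 1}

/-- The vector field `X_i`, as an `ℝⁿ`-valued map. -/
noncomputable def X (i : G.Horizontal) (x : EuclideanSpace ℝ (Fin n)) :
    EuclideanSpace ℝ (Fin n) :=
  jacobianField G.op i.1 x

/-- The derivative `X_i f` of a function `f` along the vector field `X_i`. -/
noncomputable def XDeriv {F : Type*} [NormedAddCommGroup F] [NormedSpace ℝ F]
    (i : G.Horizontal) (f : EuclideanSpace ℝ (Fin n) → F) (x : EuclideanSpace ℝ (Fin n)) : F :=
  fderiv ℝ f x (G.X i x)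

/-- The `p`-angle function `𝒲_p(x) = (∑ᵢ |⟨X_i(x), v⟩| ^ p) ^ (1 / p)` for a normal `v`. -/
noncomputable def angleFun (p : ℝ) (v x : EuclideanSpace ℝ (Fin n)) : ℝ :=
  (∑ i : G.Horizontal, |inner ℝ (G.X i x) v| ^ p) ^ (1 / p)

/-- `X_i⟨X_i(x), v⟩`: the derivative at `x`, along `X_i`, of `y ↦ ⟨X_i(y), v⟩`, for a vector `v`
which is not differentiated. -/
noncomputable def normalDeriv (i : G.Horizontal) (v x : EuclideanSpace ℝ (Fin n)) : ℝ :=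
  G.XDeriv i (fun y => inner ℝ (G.X i y) v) x

/-- The `i`-th summand
`(|⟨X_i(x), ν(x)⟩| / dist(x, ∂Ω)) ^ (p - 2) * (X_i⟨X_i(x), ν⟩ / dist(x, ∂Ω)) * |u(x)| ^ p`. -/
noncomputable def hardyTerm {𝕜 : Type*} [RCLike 𝕜] (Ω : Set (EuclideanSpace ℝ (Fin n)))
    (ν : EuclideanSpace ℝ (Fin n) → EuclideanSpace ℝ (Fin n)) (p : ℝ)
    (u : EuclideanSpace ℝ (Fin n) → 𝕜) (i : G.Horizontal) (x : EuclideanSpace ℝ (Fin n)) : ℝ :=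
  (|inner ℝ (G.X i x) (ν x)| / Metric.infDist x (frontier Ω)) ^ (p - 2) *
    (G.normalDeriv i (ν x) x / Metric.infDist x (frontier Ω)) * ‖u x‖ ^ p

end StratifiedGroup

/-- `v` is an inward unit normal of the convex set `Ω` at the boundary point `y`. -/
def IsInwardUnitNormal {n : ℕ} (Ω : Set (EuclideanSpace ℝ (Fin n)))
    (y v : EuclideanSpace ℝ (Fin n)) : Prop :=
  ‖v‖ = 1 ∧ ∀ z ∈ Ω, 0 ≤ inner ℝ (z - y) v

/-- For each `x ∈ Ω`, `ν x` is the inward unit normal of `∂Ω` at a point of `∂Ω` which is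
nearest to `x`. -/
def IsNormalMap {n : ℕ} (Ω : Set (EuclideanSpace ℝ (Fin n)))
    (ν : EuclideanSpace ℝ (Fin n) → EuclideanSpace ℝ (Fin n)) : Prop :=
  ∀ x ∈ Ω, ∃ y ∈ frontier Ω, dist x y = Metric.infDist x (frontier Ω) ∧
    IsInwardUnitNormal Ω y (ν x)

open MeasureTheory Filter Topology Set Metric

/-! The normal field `ν` is a supergradient of the distance `d` to the boundary. Hence `ν = ∇d`
almost everywhere (Rademacher), `ν` is continuous relative to `Ω` at every point of
differentiability of `d`, and `-ν` is monotone, which is the concavity of `d` in first-order form.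

Fix a horizontal field `X = X_i` and put `s = ⟨X, ν⟩`. Formally, `X s = ⟨(DX) X, ν⟩ + ⟨X, D²d X⟩ ≤
⟨(DX) X, ν⟩`. Since `X` is divergence-free, integrating `X (h(s))` against a test function `ψ ≥ 0`,
with `h` nondecreasing, gives `0 ≤ ∫ h'(s) ⟨(DX) X, ν⟩ ψ + h(s) Xψ`. This is proved without second
derivatives of `d` (`integral_deriv_angle_nonneg`): `D²d ≤ 0` is replaced by monotonicity of `-ν`
along the displacement `x ↦ x ∘ (t e_i)`, and zero divergence by the invariance of Lebesgue measure
under right translations.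

Take `ψ = d ^ (1 - p) |u| ^ p` and `h(s) = |s| ^ (p - 2) s`. As `X d = s`, the derivative `Xψ`
produces the Hardy weight, and the first term is `(p - 1)` times the term `T_i`. Multiplying by `-β
> 0` and applying Young's inequality to the part with `X |u| ^ p` (`mul_abs_rpow_mul_le`) gives the
inequality for one field; the result is the sum over `i`.

For `p < 2` this `h` is not `C¹`. It is approximated by nondecreasing `C¹` functions with
derivatives bounded by a multiple of `|s| ^ (p - 2)`; Fatou's lemma turns integrability of the
positive part of `T_i` into that of `T_i`, and dominated convergence gives the limit
(`integrable_and_integral_nonneg_of_approx`). -/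

/-! ### Distance to the boundary and its supergradients -/

theorem ball_infDist_frontier_subset {E : Type*} [NormedAddCommGroup E] [NormedSpace ℝ E]
    {Ω : Set E} (hΩ : IsOpen Ω) {x : E} (hx : x ∈ Ω) :
    ball x (infDist x (frontier Ω)) ⊆ Ω := by
  by_cases h0 : infDist x (frontier Ω) ≤ 0
  · rw [ball_eq_empty.2 h0]; exact empty_subset _
  push Not at h0
  have hd : Disjoint (ball x (infDist x (frontier Ω))) (frontier Ω) := disjoint_ball_infDist
  have hcover : ball x (infDist x (frontier Ω)) ⊆ Ω ∪ (closure Ω)ᶜ := fun y hy => by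
    by_cases hyΩ : y ∈ Ω
    · exact Or.inl hyΩ
    · refine Or.inr fun hyc => disjoint_left.1 hd hy ?_
      rw [hΩ.frontier_eq]; exact ⟨hyc, hyΩ⟩
  have hempty : ball x (infDist x (frontier Ω)) ∩ (Ω ∩ (closure Ω)ᶜ) = ∅ := by
    ext y
    simp only [mem_inter_iff, mem_compl_iff, mem_empty_iff_false, iff_false]
    rintro ⟨-, h1, h2⟩
    exact h2 (subset_closure h1)
  -- The ball misses the frontier, so it is covered by `Ω` and the exterior; being connected, it
  -- lies in the one containing its centre.
  exact (isPreconnected_iff_subset_of_disjoint.1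
    (convex_ball x (infDist x (frontier Ω))).isPreconnected Ω (closure Ω)ᶜ hΩ
    isClosed_closure.isOpen_compl hcover hempty).resolve_right
    fun h => h (mem_ball_self h0) (subset_closure hx)

theorem infDist_frontier_pos {E : Type*} [NormedAddCommGroup E] [NormedSpace ℝ E]
    {Ω : Set E} (hΩ : IsOpen Ω) (hne : Ω ≠ univ) {x : E} (hx : x ∈ Ω) :
    0 < infDist x (frontier Ω) := by
  have hfr : (frontier Ω).Nonempty := nonempty_frontier_iff.2 ⟨⟨x, hx⟩, hne⟩
  refine (isClosed_frontier.notMem_iff_infDist_pos hfr).1 fun h => ?_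
  rw [hΩ.frontier_eq] at h
  exact h.2 hx

/-- The normal at a nearest boundary point is a supergradient of the distance function. -/
theorem IsNormalMap.infDist_le {n : ℕ} {Ω : Set (EuclideanSpace ℝ (Fin n))}
    {ν : EuclideanSpace ℝ (Fin n) → EuclideanSpace ℝ (Fin n)} (hν : IsNormalMap Ω ν)
    (hΩ : IsOpen Ω) {x z : EuclideanSpace ℝ (Fin n)} (hx : x ∈ Ω) (hz : z ∈ Ω) :
    infDist z (frontier Ω) ≤ infDist x (frontier Ω) + inner ℝ (z - x) (ν x) := by
  obtain ⟨y, hy, hxy, hnorm, hin⟩ := hν x hx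
  have h1 : infDist z (frontier Ω) ≤ inner ℝ (z - y) (ν x) := by
    refine le_of_forall_lt fun t ht => ?_
    rcases lt_or_ge t 0 with ht0 | ht0
    · exact ht0.trans_le (hin z hz)
    obtain ⟨s, hts, hs⟩ := exists_between ht
    refine hts.trans_le ?_
    -- Moving from `z` against the normal by any `s` below the distance stays in `Ω`; the half-space
    -- condition there says that `z` has height at least `s` over the supporting hyperplane at `y`.
    have hm : z - s • ν x ∈ Ω := by
      refine ball_infDist_frontier_subset hΩ hz ?_
      rw [mem_ball, dist_eq_norm, sub_sub_cancel_left, norm_neg, norm_smul, hnorm, mul_one,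
        Real.norm_of_nonneg (ht0.trans hts.le)]
      exact hs
    have := hin _ hm
    rw [sub_right_comm, inner_sub_left, inner_smul_left, real_inner_self_eq_norm_sq, hnorm] at this
    simpa using this
  have h2 : inner ℝ (x - y) (ν x) ≤ infDist x (frontier Ω) := by
    rw [← hxy, dist_eq_norm]
    simpa [hnorm] using real_inner_le_norm (x - y) (ν x)
  have h3 : inner ℝ (z - y) (ν x) = inner ℝ (x - y) (ν x) + inner ℝ (z - x) (ν x) := by
    rw [← inner_add_left]; congr 1; abel
  linarith

theorem IsNormalMap.norm_eq_one {n : ℕ} {Ω : Set (EuclideanSpace ℝ (Fin n))}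
    {ν : EuclideanSpace ℝ (Fin n) → EuclideanSpace ℝ (Fin n)} (hν : IsNormalMap Ω ν)
    {x : EuclideanSpace ℝ (Fin n)} (hx : x ∈ Ω) : ‖ν x‖ = 1 :=
  let ⟨_, _, _, h, _⟩ := hν x hx; h

section Supergradient

variable {E : Type*} [NormedAddCommGroup E] [InnerProductSpace ℝ E]
  {Ω : Set E} {d : E → ℝ} {ν : E → E}

/-- A supergradient at a point of differentiability is the gradient. -/
theorem fderiv_eq_inner_of_supergradient (hΩ : IsOpen Ω)
    (hS : ∀ x ∈ Ω, ∀ z ∈ Ω, d z ≤ d x + inner ℝ (z - x) (ν x)) {x : E} (hx : x ∈ Ω)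
    (hd : DifferentiableAt ℝ d x) (v : E) : fderiv ℝ d x v = inner ℝ v (ν x) := by
  have hmax : IsLocalMax (fun z => d z - inner ℝ z (ν x)) x := by
    filter_upwards [hΩ.mem_nhds hx] with z hz
    have := hS x hx z hz
    rw [inner_sub_left] at this
    linarith
  have hlin : HasFDerivAt (fun z : E => inner ℝ z (ν x)) (innerSL ℝ (ν x)) x := by
    have : (fun z : E => inner ℝ z (ν x)) = innerSL ℝ (ν x) := by
      ext z; simp [real_inner_comm]
    rw [this]; exact (innerSL ℝ (ν x)).hasFDerivAt
  have h0 := hmax.hasFDerivAt_eq_zero (hd.hasFDerivAt.sub hlin)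
  have := congrArg (fun L : E →L[ℝ] ℝ => L v) h0
  simp only [sub_apply, innerSL_apply_apply, zero_apply]
    at this
  rw [real_inner_comm]; linarith

/-- A bounded supergradient is continuous at points of differentiability. -/
theorem continuousWithinAt_of_supergradient (hΩ : IsOpen Ω)
    (hS : ∀ x ∈ Ω, ∀ z ∈ Ω, d z ≤ d x + inner ℝ (z - x) (ν x)) (hν : ∀ x ∈ Ω, ‖ν x‖ ≤ 1)
    {x : E} (hx : x ∈ Ω) (hd : DifferentiableAt ℝ d x) : ContinuousWithinAt ν Ω x := by
  rw [Metric.continuousWithinAt_iff]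
  intro ε hε
  have hfd := hd.hasFDerivAt
  have hlo := (hasFDerivAt_iff_isLittleO.1 hfd).bound (c := ε ^ 2 / 8) (by positivity)
  obtain ⟨ρ, hρ, hball⟩ := Metric.eventually_nhds_iff.1 (hlo.and (hΩ.mem_nhds hx))
  -- The inequalities are tested at `x + r • w` with `w = ν x - ν y`: differentiability at `x`
  -- bounds `d` there from below, the supergradient at `y` from above. Their difference is `r ‖w‖²`,
  -- up to `2 dist y x` and the differentiability error. With `r = ρ / 3` and `‖w‖ ≤ 2` the point
  -- stays in the `ρ`-ball, and each error is at most `r ε² / 4`.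
  refine ⟨ρ * ε ^ 2 / 24, by positivity, fun y hy hxy => ?_⟩
  set w := ν x - ν y with hw
  have hw2 : ‖w‖ ≤ 2 := (norm_sub_le _ _).trans (by linarith [hν x hx, hν y hy])
  set r := ρ / 3 with hr
  have hr0 : 0 < r := by positivity
  obtain ⟨hz, hzΩ⟩ := hball (y := x + r • w) (by
    rw [dist_eq_norm, add_sub_cancel_left, norm_smul, Real.norm_of_nonneg hr0.le]
    nlinarith)
  rw [add_sub_cancel_left, fderiv_eq_inner_of_supergradient hΩ hS hx hd, norm_smul,
    Real.norm_of_nonneg hr0.le, inner_smul_left] at hz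
  have h1 := hS y hy _ hzΩ
  have h2 := hS x hx y hy
  have h3 : |inner ℝ (y - x) (ν x)| ≤ dist y x :=
    (abs_real_inner_le_norm _ _).trans (by
      rw [dist_eq_norm]; exact mul_le_of_le_one_right (norm_nonneg _) (hν x hx))
  have h4 : |inner ℝ (x - y) (ν y)| ≤ dist y x :=
    (abs_real_inner_le_norm _ _).trans (by
      rw [dist_comm, dist_eq_norm]; exact mul_le_of_le_one_right (norm_nonneg _) (hν y hy))
  have h5 : inner ℝ (x + r • w - y) (ν y) = inner ℝ (x - y) (ν y) + r * inner ℝ w (ν y) := by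
    rw [add_sub_right_comm, inner_add_left, inner_smul_left]; rfl
  have h6 : inner ℝ w (ν x) - inner ℝ w (ν y) = ‖w‖ ^ 2 := by
    rw [← inner_sub_right, ← hw, real_inner_self_eq_norm_sq]
  have h7 := abs_le.1 (Real.norm_eq_abs _ ▸ hz)
  have h8 := abs_le.1 h3
  have h9 := abs_le.1 h4
  simp only [conj_trivial] at h7
  have h10 : r * ‖w‖ ^ 2 ≤ ε ^ 2 / 8 * (r * ‖w‖) + 2 * dist y x := by
    rw [← h6, mul_sub]; linarith [h7.1]
  have h11 : r * ‖w‖ ^ 2 < r * ε ^ 2 := by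
    have : ε ^ 2 / 8 * (r * ‖w‖) ≤ ε ^ 2 / 8 * (r * 2) := by gcongr
    have e1 : ρ * ε ^ 2 / 24 = r * ε ^ 2 / 8 := by rw [hr]; ring
    have : 0 < r * ε ^ 2 := by positivity
    nlinarith
  rw [dist_comm, dist_eq_norm, ← hw]
  exact lt_of_pow_lt_pow_left₀ 2 hε.le (lt_of_mul_lt_mul_left h11 hr0.le)

/-- The choice of a nearest boundary point need not be measurable, but almost everywhere it is
irrelevant: the supergradient equals the gradient, which is measurable. -/
theorem aemeasurable_of_supergradient [FiniteDimensional ℝ E] [MeasurableSpace E] [BorelSpace E]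
    (hΩ : IsOpen Ω) (hS : ∀ x ∈ Ω, ∀ z ∈ Ω, d z ≤ d x + inner ℝ (z - x) (ν x))
    {μ : Measure E} (hd : ∀ᵐ x ∂μ, DifferentiableAt ℝ d x) :
    AEMeasurable ν (μ.restrict Ω) := by
  have hm : Measurable (fun x => (InnerProductSpace.toDual ℝ E).symm (fderiv ℝ d x)) :=
    (InnerProductSpace.toDual ℝ E).symm.continuous.measurable.comp (measurable_fderiv ℝ d)
  refine hm.aemeasurable.congr ?_
  filter_upwards [ae_restrict_of_ae hd, ae_restrict_mem hΩ.measurableSet] with x hx hxΩ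
  rw [LinearIsometryEquiv.symm_apply_eq]
  ext v
  rw [fderiv_eq_inner_of_supergradient hΩ hS hxΩ hx, InnerProductSpace.toDual_apply_apply,
    real_inner_comm]

end Supergradient

/-! ### Right translations and horizontal fields -/

namespace StratifiedGroup

variable {n : ℕ} (G : StratifiedGroup n)

theorem contDiff_op_left (y : EuclideanSpace ℝ (Fin n)) : ContDiff ℝ ∞ (fun x => G.op x y) :=
  G.contDiff_op.comp (contDiff_id.prodMk contDiff_const)

/-- The dilation as a linear map. -/
noncomputable def dilationL (t : ℝ) :
    EuclideanSpace ℝ (Fin n) →L[ℝ] EuclideanSpace ℝ (Fin n) :=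
  LinearMap.toContinuousLinearMap
    { toFun := weightedDilation G.weight t
      map_add' := fun x y => by ext j; simp [weightedDilation, mul_add]
      map_smul' := fun c x => by ext j; simp [weightedDilation]; ring }

theorem dilationL_apply (t : ℝ) (x : EuclideanSpace ℝ (Fin n)) :
    G.dilationL t x = weightedDilation G.weight t x := rfl

theorem continuous_dilationL_apply (x : EuclideanSpace ℝ (Fin n)) :
    Continuous (fun t => G.dilationL t x) := by
  simp only [dilationL_apply, weightedDilation]
  exact (PiLp.continuous_toLp 2 _).comp (by fun_prop)

theorem dilationL_zero (x : EuclideanSpace ℝ (Fin n)) : G.dilationL 0 x = 0 := by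
  ext j
  have : G.weight j ≠ 0 := Nat.one_le_iff_ne_zero.1 (G.weight_pos j)
  simp [dilationL_apply, weightedDilation, this]

theorem isUnit_det_dilationL {t : ℝ} (ht : 0 < t) : (G.dilationL t).det ≠ 0 := by
  have h : (G.dilationL t) ∘L (G.dilationL t⁻¹) = ContinuousLinearMap.id ℝ _ := by
    ext x j
    have : t ^ G.weight j ≠ 0 := (pow_pos ht _).ne'
    simp [dilationL_apply, weightedDilation, this]
  intro h0
  have h3 := (LinearMap.det_comp (G.dilationL t).toLinearMap (G.dilationL t⁻¹).toLinearMap).symm.trans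
    ((congrArg (fun L => LinearMap.det (ContinuousLinearMap.toLinearMap L)) h).trans
      LinearMap.det_id)
  rw [ContinuousLinearMap.det] at h0
  rw [h0, zero_mul] at h3
  exact zero_ne_one h3

/-- Since dilations are automorphisms, the chain rule makes the determinant invariant under `(x, y)
↦ (δ_t x, δ_t y)`. As `t → 0` both points tend to `0`, where the differential is the identity, so
continuity fixes the value. -/
theorem det_fderiv_op_left (x y : EuclideanSpace ℝ (Fin n)) :
    (fderiv ℝ (fun x => G.op x y) x).det = 1 := by
  have hdil : ∀ t : ℝ, 0 < t →
      (fderiv ℝ (fun x => G.op x (G.dilationL t y)) (G.dilationL t x)).det =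
        (fderiv ℝ (fun x => G.op x y) x).det := by
    intro t ht
    have hd : ∀ y, Differentiable ℝ (fun x => G.op x y) := fun y =>
      (G.contDiff_op_left y).differentiable (by simp)
    have h1 : (fun x => G.dilationL t (G.op x y)) =
        (fun x => G.op (G.dilationL t x) (G.dilationL t y)) := by
      ext1 x; exact G.dilation_op t ht x y
    have h2 := ((G.dilationL t).hasFDerivAt.comp x (hd y x).hasFDerivAt)
    have h3 := ((hd (G.dilationL t y) (G.dilationL t x)).hasFDerivAt.comp x
      (G.dilationL t).hasFDerivAt)
    have h4 := h2.unique (h3.congr_of_eventuallyEq (Eventually.of_forall (congrFun h1)))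
    have h6 := (LinearMap.det_comp (G.dilationL t).toLinearMap _).symm.trans
      ((congrArg (fun L => LinearMap.det (ContinuousLinearMap.toLinearMap L)) h4).trans
        (LinearMap.det_comp _ (G.dilationL t).toLinearMap))
    rw [mul_comm] at h6
    exact (mul_right_cancel₀ (G.isUnit_det_dilationL ht) h6).symm
  have hc : Continuous (fun q : EuclideanSpace ℝ (Fin n) × EuclideanSpace ℝ (Fin n) =>
      (fderiv ℝ (fun x => G.op x q.2) q.1).det) := by
    refine ContinuousLinearMap.continuous_det.comp ?_
    refine (ContDiff.fderiv (m := ∞) (n := 0) ?_ contDiff_fst (by simp)).continuous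
    exact G.contDiff_op.comp (contDiff_snd.prodMk (contDiff_snd.comp contDiff_fst))
  have hlim : Tendsto (fun t : ℝ =>
      (fderiv ℝ (fun x => G.op x (G.dilationL t y)) (G.dilationL t x)).det) (𝓝[>] 0)
      (𝓝 ((fderiv ℝ (fun x => G.op x 0) 0).det)) := by
    have := (hc.comp ((G.continuous_dilationL_apply x).prodMk
      (G.continuous_dilationL_apply y))).tendsto 0
    simp only [Function.comp_def, dilationL_zero] at this
    exact this.mono_left nhdsWithin_le_nhds
  have h0 : (fderiv ℝ (fun x => G.op x 0) 0).det = 1 := by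
    simp only [G.op_zero]
    rw [fderiv_fun_id]
    simp [ContinuousLinearMap.det]
  rw [h0] at hlim
  refine tendsto_nhds_unique (tendsto_const_nhds.congr' ?_) hlim
  filter_upwards [self_mem_nhdsWithin] with t ht
  exact (hdil t ht).symm

/-- Right translations of a stratified group preserve Lebesgue measure. -/
theorem measurePreserving_op_left (y : EuclideanSpace ℝ (Fin n)) :
    MeasurePreserving (fun x => G.op x y) := by
  have hm : Measurable (fun x => G.op x y) := (G.contDiff_op_left y).continuous.measurable
  have hinj : Function.Injective (fun x => G.op x y) := fun a b h => by
    have := congrArg (fun z => G.op z (G.inv y)) h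
    simpa [G.op_assoc, G.op_inv, G.op_zero] using this
  refine ⟨hm, ?_⟩
  ext s hs
  rw [Measure.map_apply hm hs]
  have hsurj : (fun x => G.op x y) '' ((fun x => G.op x y) ⁻¹' s) = s := by
    refine image_preimage_eq_of_subset fun z _ => ⟨G.op z (G.inv y), ?_⟩
    simp [G.op_assoc, G.inv_op, G.op_zero]
  have := lintegral_image_eq_lintegral_abs_det_fderiv_mul volume (hm hs)
    (f' := fun x => fderiv ℝ (fun x => G.op x y) x)
    (fun x _ => (((G.contDiff_op_left y).differentiable (by simp)) x).hasFDerivAt.hasFDerivWithinAt)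
    hinj.injOn (fun _ => 1)
  rw [hsurj] at this
  simpa [det_fderiv_op_left] using this.symm

theorem contDiff_X (i : G.Horizontal) : ContDiff ℝ ∞ (G.X i) :=
  ContDiff.fderiv_apply (m := ∞) (f := G.op) G.contDiff_op contDiff_const contDiff_const (by simp)

theorem hasDerivAt_op_smul (i : G.Horizontal) (x : EuclideanSpace ℝ (Fin n)) :
    HasDerivAt (fun t : ℝ => G.op x (t • EuclideanSpace.single i.1 1)) (G.X i x) 0 := by
  have h1 : HasFDerivAt (G.op x) (fderiv ℝ (G.op x) 0)
      ((0 : ℝ) • EuclideanSpace.single i.1 (1 : ℝ)) := by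
    rw [zero_smul]
    exact ((G.contDiff_op.comp (contDiff_const.prodMk contDiff_id)).differentiable
      (by simp) 0).hasFDerivAt
  have h2 : HasDerivAt (fun t : ℝ => t • EuclideanSpace.single i.1 (1 : ℝ))
      (EuclideanSpace.single i.1 1) 0 := by
    simpa using (hasDerivAt_id (0 : ℝ)).smul_const (EuclideanSpace.single i.1 (1 : ℝ))
  exact h1.comp_hasDerivAt 0 h2

theorem normalDeriv_eq (i : G.Horizontal) (v x : EuclideanSpace ℝ (Fin n)) :
    G.normalDeriv i v x = inner ℝ (fderiv ℝ (G.X i) x (G.X i x)) v := by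
  have hX : DifferentiableAt ℝ (G.X i) x := (G.contDiff_X i).differentiable (by simp) x
  rw [normalDeriv, XDeriv, fderiv_inner_apply ℝ hX (differentiableAt_const v)]
  simp

end StratifiedGroup

/-! ### Uniform estimates for smooth deformations of the identity -/

section Displacement

variable {E : Type*} [NormedAddCommGroup E] [InnerProductSpace ℝ E] [FiniteDimensional ℝ E]

theorem ContDiff.exists_norm_sub_le_mul {F : Type*} [NormedAddCommGroup F] [NormedSpace ℝ F]
    {f : ℝ → E → F} (hf : ContDiff ℝ 1 (Function.uncurry f)) (R : ℝ) :
    ∃ C : ℝ, 0 ≤ C ∧ ∀ t ∈ Icc (0 : ℝ) 1, ∀ x ∈ closedBall (0 : E) R,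
      ‖f t x - f 0 x‖ ≤ C * t := by
  obtain ⟨K, hK⟩ := hf.contDiffOn.exists_lipschitzOnWith (s := Icc (0 : ℝ) 1 ×ˢ closedBall (0 : E) R)
    one_ne_zero ((convex_Icc _ _).prod (convex_closedBall _ _))
    (isCompact_Icc.prod (isCompact_closedBall _ _))
  refine ⟨K, K.2, fun t ht x hx => ?_⟩
  have := hK.dist_le_mul (t, x) ⟨ht, hx⟩ (0, x) ⟨⟨le_rfl, zero_le_one⟩, hx⟩
  simpa [dist_eq_norm, Prod.dist_eq, abs_of_nonneg ht.1, max_eq_left ht.1] using this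

/-- Uniform first and second order bounds for the displacement along a smooth deformation `Φ` of
the identity with initial velocity `X`. -/
theorem exists_displacement_bound {Φ : ℝ → E → E} {X : E → E}
    (hΦ : ContDiff ℝ 2 (Function.uncurry Φ)) (hΦ0 : ∀ x, Φ 0 x = x) (hX : ContDiff ℝ 1 X)
    (hΦX : ∀ x, HasDerivAt (fun t => Φ t x) (X x) 0) (R : ℝ) :
    ∃ C : ℝ, 0 ≤ C ∧ ∀ t ∈ Icc (0 : ℝ) 1, ∀ x ∈ closedBall (0 : E) R,
      ‖Φ t x - x‖ ≤ C * t ∧ ‖X (Φ t x) - X x‖ ≤ C * t ∧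
        ‖Φ t x - x - t • X x‖ ≤ C * t * t := by
  obtain ⟨C₁, hC₁, h₁⟩ := (hΦ.of_le one_le_two).exists_norm_sub_le_mul R
  obtain ⟨C₂, hC₂, h₂⟩ := ContDiff.exists_norm_sub_le_mul (f := fun t x => X (Φ t x))
    (hX.comp (hΦ.of_le one_le_two)) R
  -- `Y t x` is the velocity at time `t`. It differs from `Y 0 x = X x` by `O(t)`, uniformly on the
  -- ball, and the mean value inequality turns this into the second-order bound.
  set Y : ℝ → E → E := fun t x => fderiv ℝ (Function.uncurry Φ) (t, x) (1, 0) with hY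
  have hYc : ContDiff ℝ 1 (Function.uncurry Y) :=
    (hΦ.fderiv_right (m := 1) (by norm_num)).clm_apply contDiff_const
  have hYd : ∀ t x, HasDerivAt (fun s => Φ s x) (Y t x) t := fun t x => by
    have h1 : HasFDerivAt (Function.uncurry Φ) (fderiv ℝ (Function.uncurry Φ) (t, x)) (t, x) :=
      ((hΦ.differentiable (by simp)) (t, x)).hasFDerivAt
    have h2 : HasDerivAt (fun s : ℝ => (s, x)) ((1 : ℝ), (0 : E)) t :=
      (hasDerivAt_id t).prodMk (hasDerivAt_const t x)
    exact h1.comp_hasDerivAt t h2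
  obtain ⟨C₃, hC₃, h₃⟩ := hYc.exists_norm_sub_le_mul R
  have hY0 : ∀ x, Y 0 x = X x := fun x => (hYd 0 x).unique (hΦX x)
  refine ⟨C₁ + C₂ + C₃, by positivity, fun t ht x hx => ⟨?_, ?_, ?_⟩⟩
  · have := h₁ t ht x hx
    rw [hΦ0] at this
    exact this.trans (by have := ht.1; gcongr; linarith)
  · have := h₂ t ht x hx
    simp only [hΦ0] at this
    exact this.trans (by have := ht.1; gcongr; linarith)
  · have hd : ∀ s ∈ Icc (0 : ℝ) t,
        HasDerivWithinAt (fun s => Φ s x - x - s • X x) (Y s x - X x) (Icc 0 t) s := fun s _ => by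
      have := (((hYd s x).sub_const x).sub ((hasDerivAt_id s).smul_const (X x))).hasDerivWithinAt
        (s := Icc 0 t)
      rw [one_smul] at this
      exact this
    have := norm_image_sub_le_of_norm_deriv_le_segment' hd (C := C₃ * t) (fun s hs => by
      rw [← hY0]
      refine (h₃ s ⟨hs.1, hs.2.le.trans ht.2⟩ x hx).trans ?_
      gcongr; exact hs.2.le) t ⟨ht.1, le_rfl⟩
    simp only [hΦ0, sub_self, zero_smul, sub_zero] at this
    refine this.trans ?_
    have := ht.1
    gcongr; linarith

/-- `x` is recovered from `Φ t x ∈ K` as `Ψ t (Φ t x)`, and `Ψ t` is uniformly close to the identity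
on the compact set `K` for small `t`. -/
theorem eventually_forall_mem_cthickening {X : Type*} [PseudoMetricSpace X] {Φ Ψ : ℝ → X → X}
    (hΨ : Continuous (Function.uncurry Ψ)) (hΨ0 : ∀ x, Ψ 0 x = x)
    (hΨΦ : ∀ t x, Ψ t (Φ t x) = x) {K : Set X} (hK : IsCompact K) {δ : ℝ} (hδ : 0 < δ) :
    ∀ᶠ t in 𝓝 (0 : ℝ), ∀ x, Φ t x ∈ K → x ∈ cthickening δ K := by
  have := hK.eventually_forall_of_forall_eventually (x₀ := (0 : ℝ))
    (P := fun t y => dist (Ψ t y) y < δ) fun y _ => by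
      have hc : ContinuousAt (fun z : ℝ × X => dist (Ψ z.1 z.2) z.2) (0, y) :=
        (Continuous.dist hΨ continuous_snd).continuousAt
      exact hc.eventually_lt continuousAt_const (by simpa [hΨ0] using hδ)
  filter_upwards [this] with t ht x hx
  have h1 := ht _ hx
  rw [hΨΦ] at h1
  exact mem_cthickening_of_dist_le _ _ _ _ hx h1.le

end Displacement

/-! ### The weak differential inequality for monotone fields -/

section MonotoneField

variable {E : Type*} [NormedAddCommGroup E] [InnerProductSpace ℝ E]
  {Ω : Set E} {ν X : E → E} {Φ : ℝ → E → E}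

/-- An upper bound for `⟨X, ν⟩` at `Φ t x`, when `-ν` is monotone. -/
noncomputable def displacedAngle (Φ : ℝ → E → E) (X ν : E → E) (t : ℝ) (x : E) : ℝ :=
  inner ℝ (X x) (ν x) + inner ℝ (X (Φ t x) - X x) (ν (Φ t x)) +
    ‖Φ t x - x - t • X x‖ / t * ‖ν (Φ t x) - ν x‖

theorem displacedAngle_zero (hΦ0 : ∀ x, Φ 0 x = x) (x : E) :
    displacedAngle Φ X ν 0 x = inner ℝ (X x) (ν x) := by
  simp [displacedAngle, hΦ0]

/-- Only the term `⟨X x, ν (Φ t x) - ν x⟩` needs an estimate. Monotonicity gives the upper bound `0`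
with `Φ t x - x` in place of `t • X x`; replacing one by the other costs the last summand of
`displacedAngle`. -/
theorem inner_le_displacedAngle (hmono : ∀ x ∈ Ω, ∀ z ∈ Ω, inner ℝ (z - x) (ν z - ν x) ≤ 0)
    {t : ℝ} (ht : 0 < t) {x : E} (hx : x ∈ Ω) (hΦx : Φ t x ∈ Ω) :
    inner ℝ (X (Φ t x)) (ν (Φ t x)) ≤ displacedAngle Φ X ν t x := by
  set D := ν (Φ t x) - ν x with hD
  have h1 := hmono x hx _ hΦx
  have h2 := (abs_le.1 (abs_real_inner_le_norm (Φ t x - x - t • X x) D)).1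
  rw [inner_sub_left (Φ t x - x), inner_smul_left] at h2
  simp only [conj_trivial] at h2
  rw [← hD] at h1
  have h3 : inner ℝ (X x) D ≤ ‖Φ t x - x - t • X x‖ / t * ‖D‖ := by
    rw [div_mul_eq_mul_div, le_div_iff₀ ht]; linarith
  have h4 : inner ℝ (X (Φ t x)) (ν (Φ t x)) =
      inner ℝ (X x) (ν x) + inner ℝ (X (Φ t x) - X x) (ν (Φ t x)) + inner ℝ (X x) D := by
    rw [hD, inner_sub_left, inner_sub_right]; ring
  rw [displacedAngle, h4]; linarith

theorem abs_displacedAngle_sub_le {C : ℝ} (hν1 : ∀ x, ‖ν x‖ ≤ 1) {t : ℝ} (ht : 0 < t) {x : E}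
    (h2 : ‖X (Φ t x) - X x‖ ≤ C * t) (h3 : ‖Φ t x - x - t • X x‖ ≤ C * t * t) :
    |displacedAngle Φ X ν t x - inner ℝ (X x) (ν x)| ≤ 3 * C * t := by
  have hC : 0 ≤ C * t := (norm_nonneg _).trans h2
  rw [displacedAngle, add_assoc, add_sub_cancel_left]
  refine (abs_add_le _ _).trans ?_
  have e1 : |inner ℝ (X (Φ t x) - X x) (ν (Φ t x))| ≤ C * t :=
    (abs_real_inner_le_norm _ _).trans
      ((mul_le_of_le_one_right (norm_nonneg _) (hν1 _)).trans h2)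
  have e2 : |‖Φ t x - x - t • X x‖ / t * ‖ν (Φ t x) - ν x‖| ≤ C * t * 2 := by
    rw [abs_of_nonneg (by positivity)]
    refine mul_le_mul ((div_le_iff₀ ht).2 h3) ?_ (norm_nonneg _) hC
    exact (norm_sub_le _ _).trans (by linarith [hν1 x, hν1 (Φ t x)])
  linarith

/-- The last summand is at most `C t` times the oscillation of `ν`, hence `o(t)` where `ν` is
continuous. Thus the error made in using monotonicity does not affect the derivative. -/
theorem hasDerivWithinAt_displacedAngle (hΩ : IsOpen Ω) (hΦ0 : ∀ x, Φ 0 x = x)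
    (hX : ContDiff ℝ 1 X) {x : E} (hΦX : HasDerivAt (fun t => Φ t x) (X x) 0)
    {C : ℝ} (hC : ∀ t ∈ Icc (0 : ℝ) 1, ‖Φ t x - x - t • X x‖ ≤ C * t * t)
    (hx : x ∈ Ω) (hν : ContinuousWithinAt ν Ω x) :
    HasDerivWithinAt (fun t => displacedAngle Φ X ν t x)
      (inner ℝ (fderiv ℝ X x (X x)) (ν x)) (Ioi 0) 0 := by
  rw [hasDerivWithinAt_iff_tendsto_slope' self_notMem_Ioi]
  have hΦt : Tendsto (fun t => Φ t x) (𝓝[>] 0) (𝓝 x) := by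
    have := hΦX.continuousAt.tendsto
    rw [hΦ0] at this
    exact this.mono_left nhdsWithin_le_nhds
  have hνt : Tendsto (fun t => ν (Φ t x)) (𝓝[>] 0) (𝓝 (ν x)) :=
    hν.tendsto.comp (tendsto_nhdsWithin_iff.2 ⟨hΦt, hΦt.eventually (hΩ.mem_nhds hx)⟩)
  have hXd : HasDerivAt (fun t => X (Φ t x)) (fderiv ℝ X x (X x)) 0 := by
    have h : HasFDerivAt X (fderiv ℝ X x) (Φ 0 x) := by
      rw [hΦ0]; exact (hX.differentiable one_ne_zero x).hasFDerivAt
    exact h.comp_hasDerivAt 0 hΦX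
  have h1 : Tendsto (fun t => inner ℝ (t⁻¹ • (X (Φ t x) - X x)) (ν (Φ t x))) (𝓝[>] 0)
      (𝓝 (inner ℝ (fderiv ℝ X x (X x)) (ν x))) := by
    have := (hasDerivWithinAt_iff_tendsto_slope' self_notMem_Ioi).1
      (hXd.hasDerivWithinAt (s := Ioi 0))
    refine Tendsto.inner (this.congr fun t => ?_) hνt
    simp [slope_def_module, hΦ0]
  have h2 : Tendsto (fun t => t⁻¹ * (‖Φ t x - x - t • X x‖ / t * ‖ν (Φ t x) - ν x‖)) (𝓝[>] 0)
      (𝓝 0) := by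
    have hz : Tendsto (fun t => C * ‖ν (Φ t x) - ν x‖) (𝓝[>] 0) (𝓝 0) := by
      simpa using ((hνt.sub_const (ν x)).norm.const_mul C)
    refine squeeze_zero' ?_ ?_ hz
    · filter_upwards [self_mem_nhdsWithin] with t (ht : 0 < t)
      positivity
    · filter_upwards [Ioc_mem_nhdsGT (zero_lt_one' ℝ)] with t ht
      have ht0 := ht.1
      rw [← mul_assoc]
      gcongr
      rw [inv_mul_le_iff₀ ht0, div_le_iff₀ ht0]
      exact (hC t ⟨ht.1.le, ht.2⟩).trans (le_of_eq (by ring))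
  have h3 := h1.add h2
  rw [add_zero] at h3
  refine h3.congr fun t => ?_
  rw [slope_def_module, displacedAngle_zero hΦ0, displacedAngle, inner_smul_left]
  simp only [conj_trivial, sub_zero, smul_eq_mul]
  ring

variable [FiniteDimensional ℝ E] [MeasurableSpace E] [BorelSpace E] {μ : Measure E} [μ.IsAddHaarMeasure]

/-- The weak form of `X (h ⟨X, ν⟩) ≤ h' ⟨X, ν⟩ * ⟨(DX) X, ν⟩` for a divergence-free field `X`,
a nondecreasing `h` and a field `ν` such that `-ν` is monotone. -/
theorem integral_deriv_angle_nonneg {Ψ : ℝ → E → E} (hΩ : IsOpen Ω)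
    (hΦ : ContDiff ℝ 2 (Function.uncurry Φ)) (hΦ0 : ∀ x, Φ 0 x = x) (hX : ContDiff ℝ 1 X)
    (hΦX : ∀ x, HasDerivAt (fun t => Φ t x) (X x) 0)
    (hΨ : Continuous (Function.uncurry Ψ)) (hΨ0 : ∀ x, Ψ 0 x = x)
    (hΨΦ : ∀ t x, Ψ t (Φ t x) = x) (hμ : ∀ t, MeasurePreserving (Φ t) μ μ)
    (hmono : ∀ x ∈ Ω, ∀ z ∈ Ω, inner ℝ (z - x) (ν z - ν x) ≤ 0)
    (hν1 : ∀ x, ‖ν x‖ ≤ 1) (hνm : AEMeasurable ν μ)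
    (hνc : ∀ᵐ x ∂μ, x ∈ Ω → ContinuousWithinAt ν Ω x)
    {ψ : E → ℝ} {L : NNReal} (hψ : LipschitzWith L ψ) (hψc : HasCompactSupport ψ)
    (hψΩ : tsupport ψ ⊆ Ω) (hψ0 : ∀ x, 0 ≤ ψ x)
    {h : ℝ → ℝ} (hh : ContDiff ℝ 1 h) (hhm : Monotone h) :
    0 ≤ ∫ x, deriv h (inner ℝ (X x) (ν x)) * inner ℝ (fderiv ℝ X x (X x)) (ν x) * ψ x +
      h (inner ℝ (X x) (ν x)) * fderiv ℝ ψ x (X x) ∂μ := by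
  obtain ⟨δ, hδ, hδΩ⟩ := IsCompact.exists_cthickening_subset_open hψc hΩ hψΩ
  -- For small `t > 0` the supports of `ψ` and of `ψ ∘ Φ t` both lie in this compact subset of `Ω`.
  set K := cthickening δ (tsupport ψ) with hKdef
  have hK : IsCompact K := IsCompact.cthickening hψc
  have hψK : tsupport ψ ⊆ K := self_subset_cthickening _
  obtain ⟨R, hR⟩ := hK.isBounded.subset_closedBall 0
  obtain ⟨C, hC0, hC⟩ := exists_displacement_bound hΦ hΦ0 hX hΦX R
  obtain ⟨P, hP⟩ := hψc.exists_bound_of_continuous hψ.continuous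
  have hP0 : 0 ≤ P := (norm_nonneg _).trans (hP 0)
  obtain ⟨M, hM⟩ := hK.exists_bound_of_continuousOn hX.continuous.continuousOn
  set s : E → ℝ := fun x => inner ℝ (X x) (ν x) with hs
  have hsM : ∀ x ∈ K, |s x| ≤ M := fun x hx => (abs_real_inner_le_norm _ _).trans
    ((mul_le_of_le_one_right (norm_nonneg _) (hν1 x)).trans (hM x hx))
  -- `|s| ≤ M` on `K`, and the displaced angle differs from `s` by at most `3 C t ≤ 3 C`; so `h` is
  -- only evaluated on this interval.
  set I := Icc (-(M + 3 * C)) (M + 3 * C) with hI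
  obtain ⟨Lh, hLh⟩ := (hh.contDiffOn (s := I)).exists_lipschitzOnWith one_ne_zero
    (convex_Icc _ _) isCompact_Icc
  obtain ⟨H, hH⟩ := (isCompact_Icc (a := -(M + 3 * C)) (b := M + 3 * C)).exists_bound_of_continuousOn
    hh.continuous.continuousOn
  have hsI : ∀ x ∈ K, s x ∈ I := fun x hx => by
    have := abs_le.1 (hsM x hx); constructor <;> linarith
  have hrI : ∀ t ∈ Ioc (0 : ℝ) 1, ∀ x ∈ K, |displacedAngle Φ X ν t x - s x| ≤ 3 * C * t ∧
      displacedAngle Φ X ν t x ∈ I := fun t ht x hx => by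
    have h1 := hC t ⟨ht.1.le, ht.2⟩ x (hR hx)
    have h2 := abs_displacedAngle_sub_le hν1 ht.1 h1.2.1 h1.2.2
    refine ⟨h2, ?_⟩
    have h3 := abs_le.1 (hsM x hx)
    have h4 := abs_le.1 h2
    have h5 : 3 * C * t ≤ 3 * C := mul_le_of_le_one_right (by positivity) ht.2
    simp only [hs] at h3
    constructor <;> linarith
  have hsm : AEMeasurable s μ := hX.continuous.aemeasurable.inner hνm
  have hΦm : ∀ t, Measurable (Φ t) := fun t => (hμ t).measurable
  have hrm : ∀ t, AEMeasurable (displacedAngle Φ X ν t) μ := fun t => by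
    have h1 : AEMeasurable (fun x => ν (Φ t x)) μ :=
      hνm.comp_quasiMeasurePreserving (hμ t).quasiMeasurePreserving
    have hXm : Measurable X := hX.continuous.measurable
    refine (hsm.add (((hXm.comp (hΦm t)).sub hXm).aemeasurable.inner h1)).add ?_
    exact (((((hΦm t).sub measurable_id).sub (hXm.const_smul t)).norm.div_const t).aemeasurable).mul
      (h1.sub hνm).norm
  set F : E → ℝ := fun x => h (s x) * ψ x with hF
  have hψm : Measurable ψ := hψ.continuous.measurable
  have hFm : AEMeasurable F μ :=
    (hh.continuous.measurable.comp_aemeasurable hsm).mul hψm.aemeasurable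
  have hψz : ∀ x, x ∉ K → ψ x = 0 := fun x hx => image_eq_zero_of_notMem_tsupport fun hx' => hx (hψK hx')
  have hKi : ∀ c : ℝ, Integrable (K.indicator fun _ => c) μ := fun c =>
    (integrable_indicator_iff hK.measurableSet).2 (integrableOn_const hK.measure_lt_top.ne)
  have hFi : Integrable F μ := by
    refine (hKi (H * P)).mono' hFm.aestronglyMeasurable (Eventually.of_forall fun x => ?_)
    by_cases hx : x ∈ K
    · rw [indicator_of_mem hx, norm_mul]
      exact mul_le_mul (hH _ (hsI x hx)) (hP x) (norm_nonneg _) ((norm_nonneg _).trans (hH _ (hsI x hx)))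
    · rw [indicator_of_notMem hx, hF]; simp [hψz x hx]
  -- `B t` majorizes the difference quotient of `F = h(s) ψ` along `Φ`. The quotient itself need not
  -- converge, as `ν` may fail to be differentiable; the majorant does, almost everywhere.
  set B : ℝ → E → ℝ := fun t => K.indicator fun x =>
    t⁻¹ * (h (displacedAngle Φ X ν t x) * ψ (Φ t x) - F x) with hB
  have hBm : ∀ t, AEStronglyMeasurable (B t) μ := fun t => by
    refine AEMeasurable.aestronglyMeasurable (AEMeasurable.indicator ?_ hK.measurableSet)
    exact (((hh.continuous.measurable.comp_aemeasurable (hrm t)).mul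
      (hψm.comp (hΦm t)).aemeasurable).sub hFm).const_mul _
  set bd : ℝ := Lh * (3 * C) * P + H * (L * C) with hbd
  have hBb : ∀ t ∈ Ioc (0 : ℝ) 1, ∀ x, ‖B t x‖ ≤ K.indicator (fun _ => bd) x := fun t ht x => by
    by_cases hx : x ∈ K
    swap
    · simp [hB, hx]
    simp only [hB, indicator_of_mem hx]
    obtain ⟨h1, h2⟩ := hrI t ht x hx
    have ht0 := ht.1
    rw [norm_mul, norm_inv, Real.norm_of_nonneg ht0.le, inv_mul_le_iff₀ ht0]
    have e1 : ‖h (displacedAngle Φ X ν t x) - h (s x)‖ ≤ Lh * (3 * C * t) := by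
      rw [← dist_eq_norm]
      refine (hLh.dist_le_mul _ h2 _ (hsI x hx)).trans ?_
      gcongr; exact h1
    have e2 : ‖ψ (Φ t x) - ψ x‖ ≤ L * (C * t) := by
      rw [← dist_eq_norm]
      refine (hψ.dist_le_mul _ _).trans ?_
      gcongr; rw [dist_eq_norm]; exact (hC t ⟨ht.1.le, ht.2⟩ x (hR hx)).1
    have e3 : h (displacedAngle Φ X ν t x) * ψ (Φ t x) - F x =
        (h (displacedAngle Φ X ν t x) - h (s x)) * ψ (Φ t x) +
          h (s x) * (ψ (Φ t x) - ψ x) := by rw [hF]; ring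
    rw [e3]
    refine (norm_add_le _ _).trans ?_
    rw [norm_mul, norm_mul]
    have e4 := mul_le_mul e1 (hP (Φ t x)) (norm_nonneg _) (by positivity)
    have e5 := mul_le_mul (hH _ (hsI x hx)) e2 (norm_nonneg _)
      ((norm_nonneg _).trans (hH _ (hsI x hx)))
    refine (add_le_add e4 e5).trans (le_of_eq ?_)
    rw [hbd]; ring
  have hnonneg : ∀ᶠ t in 𝓝[>] (0 : ℝ), 0 ≤ ∫ x, B t x ∂μ := by
    filter_upwards [Ioc_mem_nhdsGT (zero_lt_one' ℝ), nhdsWithin_le_nhds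
      (eventually_forall_mem_cthickening hΨ hΨ0 hΨΦ hψc hδ)] with t ht htK
    have hΦe : MeasurableEmbedding (Φ t) :=
      Measurable.measurableEmbedding (hΦm t) (fun a b hab => by
        rw [← hΨΦ t a, hab, hΨΦ])
    have hFΦi : Integrable (fun x => F (Φ t x)) μ := ((hμ t).integrable_comp_emb hΦe).2 hFi
    -- Measure preservation takes the place of integration by parts for a divergence-free field.
    have hint : ∫ x, t⁻¹ * (F (Φ t x) - F x) ∂μ = 0 := by
      rw [integral_const_mul, integral_sub hFΦi hFi,
        (hμ t).integral_comp hΦe, sub_self, mul_zero]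
    rw [← hint]
    refine integral_mono ((hFΦi.sub hFi).const_mul _)
      ((hKi bd).mono' (hBm t) (Eventually.of_forall (hBb t ht))) fun x => ?_
    by_cases hx : x ∈ K
    · simp only [hB, indicator_of_mem hx]
      have := ht.1
      gcongr
      by_cases hΦx : Φ t x ∈ tsupport ψ
      · exact mul_le_mul_of_nonneg_right
          (hhm (inner_le_displacedAngle hmono ht.1 (hδΩ hx) (hψΩ hΦx))) (hψ0 _)
      · rw [hF]; simp [image_eq_zero_of_notMem_tsupport hΦx]
    · have hΦx : Φ t x ∉ tsupport ψ := fun h' => hx (htK x h')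
      simp [hB, hF, hx, hψz x hx, image_eq_zero_of_notMem_tsupport hΦx]
  refine ge_of_tendsto (tendsto_integral_filter_of_dominated_convergence _
    (Eventually.of_forall hBm) ?_ (hKi bd) ?_) hnonneg
  · filter_upwards [Ioc_mem_nhdsGT (zero_lt_one' ℝ)] with t ht
    exact Eventually.of_forall (hBb t ht)
  filter_upwards [hνc, hψ.ae_differentiableAt (μ := μ)] with x hνx hψx
  by_cases hx : x ∈ K
  swap
  · have h1 : fderiv ℝ ψ x = 0 := image_eq_zero_of_notMem_tsupport
      fun h' => hx (hψK (tsupport_fderiv_subset ℝ h'))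
    simp [hB, hx, h1, hψz x hx]
  simp only [hB, indicator_of_mem hx]
  have d1 := hasDerivWithinAt_displacedAngle hΩ hΦ0 hX (hΦX x)
    (fun t ht => (hC t ht x (hR hx)).2.2) (hδΩ hx) (hνx (hδΩ hx))
  have d2 : HasDerivAt h (deriv h (s x)) (displacedAngle Φ X ν 0 x) := by
    rw [displacedAngle_zero hΦ0]; exact (hh.differentiable one_ne_zero _).hasDerivAt
  have d3 : HasFDerivAt ψ (fderiv ℝ ψ x) (Φ 0 x) := by rw [hΦ0]; exact hψx.hasFDerivAt
  have d4 := (d2.comp_hasDerivWithinAt 0 d1).mul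
    (d3.comp_hasDerivAt 0 (hΦX x)).hasDerivWithinAt
  have d5 := (hasDerivWithinAt_iff_tendsto_slope' self_notMem_Ioi).1 d4
  simp only [Function.comp_apply, displacedAngle_zero hΦ0, hΦ0] at d5
  refine d5.congr fun t => ?_
  simp [slope_def_module, displacedAngle_zero hΦ0, hΦ0, hF, hs]

end MonotoneField

/-! ### Approximation of the power nonlinearity and passage to the limit -/

theorem hasDerivAt_abs_rpow_mul_self {p : ℝ} (hp : 2 ≤ p) (s : ℝ) :
    HasDerivAt (fun s : ℝ => |s| ^ (p - 2) * s) ((p - 1) * |s| ^ (p - 2)) s := by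
  have hc : Continuous (fun s : ℝ => |s| ^ (p - 2)) :=
    continuous_abs.rpow_const fun _ => Or.inr (by linarith)
  have key : ∀ s : ℝ, s ≠ 0 →
      HasDerivAt (fun s : ℝ => |s| ^ (p - 2) * s) ((p - 1) * |s| ^ (p - 2)) s := fun s hs => by
    have h1 := (((hasDerivAt_abs hs).rpow_const (p := p - 2)
      (Or.inl (abs_ne_zero.2 hs))).mul (hasDerivAt_id s))
    refine HasDerivAt.congr_deriv h1 ?_
    have h2 : |s| ^ (p - 2) = |s| ^ (p - 2 - 1) * |s| := by
      rw [← Real.rpow_add_one (abs_ne_zero.2 hs)]; congr 1; ring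
    have h3 : ((SignType.sign s : SignType) : ℝ) * s = |s| := sign_mul_self s
    rw [mul_one, id]
    linear_combination (p - 2) * |s| ^ (p - 2 - 1) * h3 - (p - 2) * h2
  by_cases hs : s = 0
  · subst hs
    exact hasDerivAt_of_hasDerivAt_of_ne (fun y hy => key y hy)
      (hc.mul continuous_id).continuousAt (continuous_const.mul hc).continuousAt
  · exact key s hs

theorem sq_rpow_half_mul_sq {s : ℝ} (hs : s ≠ 0) (p : ℝ) :
    (s ^ 2) ^ ((p - 4) / 2) * s ^ 2 = |s| ^ (p - 2) := by
  rw [← sq_abs, ← Real.rpow_natCast |s| 2, ← Real.rpow_mul (abs_nonneg s),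
    ← Real.rpow_add (abs_pos.2 hs)]
  congr 1; push_cast; ring

theorem hasDerivAt_cube_mul_rpow {η : ℝ} (hη : 0 < η) (p s : ℝ) :
    HasDerivAt (fun s : ℝ => s ^ 3 * (s ^ 2 + η) ^ ((p - 4) / 2))
      (3 * s ^ 2 * (s ^ 2 + η) ^ ((p - 4) / 2) +
        (p - 4) * s ^ 4 * (s ^ 2 + η) ^ ((p - 4) / 2 - 1)) s := by
  have hA : s ^ 2 + η ≠ 0 := by positivity
  have h1 := ((hasDerivAt_pow 3 s).mul
    (((hasDerivAt_pow 2 s).add_const η).rpow_const (p := (p - 4) / 2) (Or.inl hA)))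
  refine h1.congr_deriv ?_
  push_cast; ring

/-- The function `s ↦ |s| ^ (p - 2) * s` is a limit of nondecreasing `C¹` functions whose
derivatives are dominated by `|s| ^ (p - 2)`, with `0 ^ (p - 2) = 0` if `p < 2`. -/
theorem exists_seq_tendsto_abs_rpow_mul_self {p : ℝ} (hp : 1 < p) :
    ∃ h : ℕ → ℝ → ℝ, (∀ k, ContDiff ℝ 1 (h k)) ∧ (∀ k, Monotone (h k)) ∧
      (∀ k s, 0 ≤ deriv (h k) s) ∧ (∀ k s, deriv (h k) s ≤ max 3 (p - 1) * |s| ^ (p - 2)) ∧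
      (∀ k s, |h k s| ≤ |s| ^ (p - 1)) ∧
      (∀ s, Tendsto (fun k => deriv (h k) s) atTop (𝓝 ((p - 1) * |s| ^ (p - 2)))) ∧
      ∀ s, Tendsto (fun k => h k s) atTop (𝓝 (|s| ^ (p - 2) * s)) := by
  have habs : ∀ s : ℝ, s ≠ 0 → |s| ^ (p - 2) * |s| = |s| ^ (p - 1) := fun s hs => by
    rw [← Real.rpow_add_one (abs_ne_zero.2 hs)]; congr 1; ring
  rcases le_or_gt 2 p with hp2 | hp2
  · have hd := hasDerivAt_abs_rpow_mul_self hp2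
    have hd' : deriv (fun s : ℝ => |s| ^ (p - 2) * s) = fun s => (p - 1) * |s| ^ (p - 2) :=
      funext fun s => (hd s).deriv
    have hd0 : ∀ s, 0 ≤ deriv (fun s : ℝ => |s| ^ (p - 2) * s) s := fun s => by
      rw [hd']
      have : 0 ≤ p - 1 := by linarith
      positivity
    refine ⟨fun _ s => |s| ^ (p - 2) * s, fun _ => ?_, fun _ => ?_, fun _ => hd0, fun _ s => ?_,
      fun _ s => ?_, fun s => ?_, fun s => tendsto_const_nhds⟩
    · refine contDiff_one_iff_deriv.2 ⟨fun s => (hd s).differentiableAt, ?_⟩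
      rw [hd']
      exact continuous_const.mul (continuous_abs.rpow_const fun _ => Or.inr (by linarith))
    · exact monotone_of_deriv_nonneg (fun s => (hd s).differentiableAt) hd0
    · simp only [hd']
      gcongr
      exact le_max_right _ _
    · by_cases hs : s = 0
      · subst hs; simp only [mul_zero, abs_zero]; positivity
      · rw [abs_mul, abs_of_nonneg (by positivity), habs s hs]
    · simp only [hd']; exact tendsto_const_nhds
  -- For `p < 2` the approximants are `s³ (s² + η) ^ ((p - 4) / 2)`. The cube makes their
  -- derivatives vanish at `s = 0`, in agreement with `0 ^ (p - 2) = 0`; those of `s (s² + η) ^ ((p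
  -- - 2) / 2)` would blow up there as `η → 0`.
  · have hη : ∀ k : ℕ, 0 < 1 / ((k : ℝ) + 1) := fun k => by positivity
    have hd := fun k : ℕ => hasDerivAt_cube_mul_rpow (hη k) p
    have hd0 : ∀ (k : ℕ) s,
        0 ≤ deriv (fun s : ℝ => s ^ 3 * (s ^ 2 + 1 / ((k : ℝ) + 1)) ^ ((p - 4) / 2)) s :=
      fun k s => by
        rw [(hd k s).deriv]
        have hA : 0 < s ^ 2 + 1 / ((k : ℝ) + 1) := by have := hη k; positivity
        rw [show (s ^ 2 + 1 / ((k : ℝ) + 1)) ^ ((p - 4) / 2) =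
          (s ^ 2 + 1 / ((k : ℝ) + 1)) ^ ((p - 4) / 2 - 1) * (s ^ 2 + 1 / ((k : ℝ) + 1)) by
            rw [← Real.rpow_add_one hA.ne']; congr 1; ring]
        set Y := (s ^ 2 + 1 / ((k : ℝ) + 1)) ^ ((p - 4) / 2 - 1) with hY
        have hY0 : 0 ≤ Y := by positivity
        have : 3 * s ^ 2 * (Y * (s ^ 2 + 1 / ((k : ℝ) + 1))) + (p - 4) * s ^ 4 * Y =
          Y * s ^ 2 * (3 * (1 / ((k : ℝ) + 1)) + (p - 1) * s ^ 2) := by ring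
        rw [this]
        have h1 : 0 ≤ p - 1 := by linarith
        positivity
    have hle : ∀ (k : ℕ) (s : ℝ), s ≠ 0 →
        (s ^ 2 + 1 / ((k : ℝ) + 1)) ^ ((p - 4) / 2) ≤ (s ^ 2) ^ ((p - 4) / 2) := fun k s hs =>
      Real.rpow_le_rpow_of_nonpos (by positivity) (by linarith [hη k]) (by linarith)
    have hlim : ∀ (s a : ℝ), s ≠ 0 →
        Tendsto (fun k : ℕ => (s ^ 2 + 1 / ((k : ℝ) + 1)) ^ a) atTop (𝓝 ((s ^ 2) ^ a)) :=
      fun s a hs => by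
        have h1 : Tendsto (fun k : ℕ => s ^ 2 + 1 / ((k : ℝ) + 1)) atTop (𝓝 (s ^ 2)) := by
          simpa using tendsto_one_div_add_atTop_nhds_zero_nat.const_add (s ^ 2)
        exact h1.rpow_const (Or.inl (by positivity))
    refine ⟨fun k s => s ^ 3 * (s ^ 2 + 1 / ((k : ℝ) + 1)) ^ ((p - 4) / 2), fun k => ?_,
      fun k => ?_, hd0, fun k s => ?_, fun k s => ?_, fun s => ?_, fun s => ?_⟩
    · exact (contDiff_id.pow 3).mul (((contDiff_id.pow 2).add contDiff_const).rpow_const_of_ne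
        fun s => by have := hη k; simp only [id]; positivity)
    · exact monotone_of_deriv_nonneg (fun s => (hd k s).differentiableAt) (hd0 k)
    · rw [(hd k s).deriv]
      by_cases hs : s = 0
      · subst hs; simp; positivity
      -- The second term of the derivative is dropped by its sign; the first one gives the constant
      -- `3`.
      have h1 : (p - 4) * s ^ 4 * (s ^ 2 + 1 / ((k : ℝ) + 1)) ^ ((p - 4) / 2 - 1) ≤ 0 := by
        have := hη k
        rw [mul_assoc]
        exact mul_nonpos_of_nonpos_of_nonneg (by linarith) (by positivity)
      have h2 := hle k s hs
      calc _ ≤ 3 * s ^ 2 * (s ^ 2 + 1 / ((k : ℝ) + 1)) ^ ((p - 4) / 2) := by linarith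
        _ ≤ 3 * s ^ 2 * (s ^ 2) ^ ((p - 4) / 2) := by gcongr
        _ = 3 * |s| ^ (p - 2) := by rw [← sq_rpow_half_mul_sq hs]; ring
        _ ≤ _ := by gcongr; exact le_max_left _ _
    · by_cases hs : s = 0
      · subst hs; simp; positivity
      have h2 := hle k s hs
      have h3 : 0 ≤ (s ^ 2 + 1 / ((k : ℝ) + 1)) ^ ((p - 4) / 2) := by
        have := hη k; positivity
      rw [abs_mul, abs_of_nonneg h3, abs_pow, ← habs s hs, ← sq_rpow_half_mul_sq hs, ← sq_abs s]
      rw [← sq_abs s] at h2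
      calc _ ≤ |s| ^ 3 * (|s| ^ 2) ^ ((p - 4) / 2) := by gcongr
        _ = _ := by ring
    · simp only [(hd _ s).deriv]
      by_cases hs : s = 0
      · subst hs
        have : p - 2 ≠ 0 := by linarith
        simp [Real.zero_rpow this]
      have h1 := ((hlim s ((p - 4) / 2) hs).const_mul (3 * s ^ 2)).add
        ((hlim s ((p - 4) / 2 - 1) hs).const_mul ((p - 4) * s ^ 4))
      convert h1 using 2
      rw [Real.rpow_sub_one (by positivity), ← sq_rpow_half_mul_sq hs]
      field_simp
      ring
    · by_cases hs : s = 0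
      · subst hs; simp
      convert (hlim s ((p - 4) / 2) hs).const_mul (s ^ 3) using 2
      rw [← sq_rpow_half_mul_sq hs]; ring

theorem MeasureTheory.Integrable.of_tendsto_of_integral_abs_le {α : Type*} [MeasurableSpace α]
    {μ : Measure α} {a : ℕ → α → ℝ} {f : α → ℝ} {M : ℝ} (ha : ∀ k, Integrable (a k) μ)
    (haM : ∀ k, ∫ x, |a k x| ∂μ ≤ M)
    (hlim : ∀ᵐ x ∂μ, Tendsto (fun k => a k x) atTop (𝓝 (f x))) : Integrable f μ := by
  refine ⟨aestronglyMeasurable_of_tendsto_ae _ (fun k => (ha k).1) hlim, ?_⟩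
  have h1 : ∫⁻ x, ‖f x‖ₑ ∂μ ≤ liminf (fun k => ∫⁻ x, ‖a k x‖ₑ ∂μ) atTop := by
    rw [lintegral_congr_ae (show (fun x => ‖f x‖ₑ) =ᵐ[μ] fun x => liminf (fun k => ‖a k x‖ₑ) atTop
      from hlim.mono fun x hx => hx.enorm.liminf_eq.symm)]
    exact lintegral_liminf_le' fun k => (ha k).1.aemeasurable.enorm
  refine h1.trans_lt (lt_of_le_of_lt ?_ (ENNReal.ofReal_lt_top (r := M)))
  refine liminf_le_of_frequently_le' (Frequently.of_forall fun k => ?_)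
  rw [← ofReal_integral_norm_eq_lintegral_enorm (ha k)]
  exact ENNReal.ofReal_le_ofReal (haM k)

/-- Passage to the limit in the approximation of `s ↦ |s| ^ (p - 2) * s` by `h k`. -/
theorem integrable_and_integral_nonneg_of_approx {α : Type*} [MeasurableSpace α]
    {μ : Measure α} {p C : ℝ} {h : ℕ → ℝ → ℝ} {s g e : α → ℝ}
    (hp : 1 < p) (hh : ∀ k, Continuous (h k))
    (hd0 : ∀ k s, 0 ≤ deriv (h k) s) (hdC : ∀ k s, deriv (h k) s ≤ C * |s| ^ (p - 2))
    (hhb : ∀ k s, |h k s| ≤ |s| ^ (p - 1))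
    (hdlim : ∀ s, Tendsto (fun k => deriv (h k) s) atTop (𝓝 ((p - 1) * |s| ^ (p - 2))))
    (hhlim : ∀ s, Tendsto (fun k => h k s) atTop (𝓝 (|s| ^ (p - 2) * s)))
    (hs : AEMeasurable s μ) (he : AEMeasurable e μ)
    (hai : ∀ k, Integrable (fun x => deriv (h k) (s x) * g x) μ)
    (hei : Integrable (fun x => |s x| ^ (p - 1) * |e x|) μ)
    (hT : Integrable (fun x => max (|s x| ^ (p - 2) * g x) 0) μ)
    (hnonneg : ∀ k, 0 ≤ ∫ x, deriv (h k) (s x) * g x + h k (s x) * e x ∂μ) :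
    Integrable (fun x => |s x| ^ (p - 2) * g x) μ ∧
      0 ≤ (p - 1) * ∫ x, |s x| ^ (p - 2) * g x ∂μ + ∫ x, |s x| ^ (p - 2) * s x * e x ∂μ := by
  have hp1 : 0 < p - 1 := by linarith
  have hbm : ∀ k, AEStronglyMeasurable (fun x => h k (s x) * e x) μ := fun k =>
    (((hh k).measurable.comp_aemeasurable hs).mul he).aestronglyMeasurable
  have hbb : ∀ k x, ‖h k (s x) * e x‖ ≤ |s x| ^ (p - 1) * |e x| := fun k x => by
    rw [norm_mul]
    exact mul_le_mul_of_nonneg_right (hhb k _) (norm_nonneg _)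
  have hbi : ∀ k, Integrable (fun x => h k (s x) * e x) μ := fun k =>
    hei.mono' (hbm k) (Eventually.of_forall (hbb k))
  have hsum : ∀ k, 0 ≤ ∫ x, deriv (h k) (s x) * g x ∂μ + ∫ x, h k (s x) * e x ∂μ := fun k => by
    rw [← integral_add (hai k) (hbi k)]; exact hnonneg k
  have hble : ∀ k, ∫ x, h k (s x) * e x ∂μ ≤ ∫ x, |s x| ^ (p - 1) * |e x| ∂μ := fun k =>
    integral_mono (hbi k) hei fun x => (le_abs_self _).trans (hbb k x)
  -- This is `|a| = 2 a⁺ - a`, with `a⁺` controlled by the positive part of the limit. The integral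
  -- of `-a` is bounded through `hsum`, so the `L¹` norms are bounded uniformly in `k`.
  have habs : ∀ k x, |deriv (h k) (s x) * g x| ≤
      2 * C * max (|s x| ^ (p - 2) * g x) 0 - deriv (h k) (s x) * g x := fun k x => by
    have h1 := hd0 k (s x)
    have h2 := hdC k (s x)
    have h3 : 0 ≤ |s x| ^ (p - 2) := by positivity
    rcases le_total 0 (g x) with hg | hg
    · rw [max_eq_left (mul_nonneg h3 hg), abs_of_nonneg (mul_nonneg h1 hg)]
      have := mul_le_mul_of_nonneg_right h2 hg
      linarith
    · rw [max_eq_right (mul_nonpos_of_nonneg_of_nonpos h3 hg),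
        abs_of_nonpos (mul_nonpos_of_nonneg_of_nonpos h1 hg)]
      linarith
  have hTi : Integrable (fun x => |s x| ^ (p - 2) * g x) μ := by
    have : Integrable (fun x => (p - 1) * (|s x| ^ (p - 2) * g x)) μ := by
      refine Integrable.of_tendsto_of_integral_abs_le hai (M :=
        2 * C * ∫ x, max (|s x| ^ (p - 2) * g x) 0 ∂μ + ∫ x, |s x| ^ (p - 1) * |e x| ∂μ)
        (fun k => ?_) (Eventually.of_forall fun x => ?_)
      · refine (integral_mono (hai k).abs ((hT.const_mul _).sub (hai k)) (habs k)).trans ?_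
        rw [integral_sub' (hT.const_mul _) (hai k), integral_const_mul]
        linarith [hsum k, hble k]
      · rw [← mul_assoc]
        exact (hdlim _).mul_const _
    simpa [hp1.ne'] using this.const_mul (p - 1)⁻¹
  refine ⟨hTi, ?_⟩
  have l1 : Tendsto (fun k => ∫ x, deriv (h k) (s x) * g x ∂μ) atTop
      (𝓝 (∫ x, (p - 1) * (|s x| ^ (p - 2) * g x) ∂μ)) := by
    refine tendsto_integral_of_dominated_convergence (fun x => C * |(|s x| ^ (p - 2) * g x)|)
      (fun k => (hai k).1) (hTi.abs.const_mul C) (fun k => Eventually.of_forall fun x => ?_)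
      (Eventually.of_forall fun x => ?_)
    · rw [norm_mul, Real.norm_of_nonneg (hd0 _ _), abs_mul, abs_of_nonneg (by positivity),
        ← mul_assoc]
      exact mul_le_mul_of_nonneg_right (hdC k _) (norm_nonneg _)
    · rw [← mul_assoc]
      exact (hdlim _).mul_const _
  have l2 : Tendsto (fun k => ∫ x, h k (s x) * e x ∂μ) atTop
      (𝓝 (∫ x, |s x| ^ (p - 2) * s x * e x ∂μ)) :=
    tendsto_integral_of_dominated_convergence _ hbm hei (fun k => Eventually.of_forall (hbb k))
      (Eventually.of_forall fun x => (hhlim _).mul_const _)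
  rw [← integral_const_mul]
  exact ge_of_tendsto' (l1.add l2) hsum

/-! ### Lipschitz test functions, Young's inequality and integrability -/

theorem lipschitzWith_max_rpow {a c : ℝ} (hc : 0 < c) (ha : a ≤ 0) :
    ∃ L : NNReal, LipschitzWith L (fun s : ℝ => max s c ^ a) := by
  have h1 : LipschitzOnWith (Real.toNNReal (|a| * c ^ (a - 1))) (fun s : ℝ => s ^ a) (Ici c) := by
    refine Convex.lipschitzOnWith_of_nnnorm_hasDerivWithin_le (convex_Ici c)
      (f' := fun s => a * s ^ (a - 1)) (fun s hs => ?_) fun s hs => ?_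
    · exact (Real.hasDerivAt_rpow_const (Or.inl (hc.trans_le hs).ne')).hasDerivWithinAt
    · rw [← NNReal.coe_le_coe, Real.coe_toNNReal _ (by positivity), coe_nnnorm, norm_mul,
        Real.norm_eq_abs, Real.norm_of_nonneg (Real.rpow_nonneg (hc.le.trans hs) _)]
      exact mul_le_mul_of_nonneg_left
        (Real.rpow_le_rpow_of_nonpos hc hs (by linarith)) (abs_nonneg a)
  refine ⟨_, lipschitzOnWith_univ.1 (h1.comp (f := fun s => max s c) (s := univ)
    ((LipschitzWith.id.max_const c).lipschitzOnWith) fun s _ => le_max_right s c)⟩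

theorem LipschitzWith.mul_of_bounded {α : Type*} [PseudoMetricSpace α] {f g : α → ℝ}
    {Lf Lg : NNReal} {A B : ℝ} (hf : LipschitzWith Lf f) (hg : LipschitzWith Lg g)
    (hfA : ∀ x, |f x| ≤ A) (hgB : ∀ x, |g x| ≤ B) :
    ∃ L : NNReal, LipschitzWith L (fun x => f x * g x) := by
  refine ⟨Real.toNNReal (Lf * B + A * Lg), LipschitzWith.of_dist_le_mul fun x y => ?_⟩
  have hA : 0 ≤ A := (abs_nonneg _).trans (hfA x)
  have hB : 0 ≤ B := (abs_nonneg _).trans (hgB x)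
  rw [Real.coe_toNNReal _ (by positivity), Real.dist_eq,
    show f x * g x - f y * g y = (f x - f y) * g x + f y * (g x - g y) by ring]
  refine (abs_add_le _ _).trans ?_
  rw [abs_mul, abs_mul, ← Real.dist_eq, ← Real.dist_eq]
  have h1 := mul_le_mul (hf.dist_le_mul x y) (hgB x) (abs_nonneg _) (by positivity)
  have h2 := mul_le_mul (hfA y) (hg.dist_le_mul x y) dist_nonneg hA
  linarith

theorem young_mul_le {p a b : ℝ} (hp : 1 < p) (ha : 0 ≤ a) (hb : 0 ≤ b) :
    p * (a * b) ≤ a ^ p + (p - 1) * b ^ (p / (p - 1)) := by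
  have hpq : p.HolderConjugate (p / (p - 1)) := Real.HolderConjugate.conjExponent hp
  have h := mul_le_mul_of_nonneg_left (Real.young_inequality_of_nonneg ha hb hpq)
    (by linarith : 0 ≤ p)
  refine h.trans (le_of_eq ?_)
  have h1 : p ≠ 0 := by linarith
  have h2 : p - 1 ≠ 0 := by linarith
  field_simp

/-- The pointwise form of Young's inequality behind the weighted Hardy inequality. -/
theorem mul_abs_rpow_mul_le {p γ s d U V Y : ℝ} (hp : 1 < p) (hγ : 0 ≤ γ) (hd : 0 < d)
    (hU : 0 ≤ U) (hV : 0 ≤ V) (hY : |Y| ≤ p * U ^ (p - 1) * V) :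
    γ * (|s| ^ (p - 2) * s * (d ^ (1 - p) * Y - (p - 1) * (d ^ (-p) * s * U ^ p))) ≤
      V ^ p + (p - 1) * (γ ^ (p / (p - 1)) - γ) * (|s| ^ p / d ^ p * U ^ p) := by
  have hp1 : 0 < p - 1 := by linarith
  have hY' := mul_le_mul_of_nonneg_left hY (abs_nonneg (|s| ^ (p - 2) * s))
  have e0 : |(|s| ^ (p - 2) * s)| = |s| ^ (p - 1) := by
    by_cases hs : s = 0
    · subst hs; simp [Real.zero_rpow hp1.ne']
    · rw [abs_mul, abs_of_nonneg (by positivity), ← Real.rpow_add_one (abs_ne_zero.2 hs)]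
      congr 1; ring
  have e1 : |s| ^ (p - 2) * s * s = |s| ^ p := by
    by_cases hs : s = 0
    · subst hs; simp [Real.zero_rpow (by linarith : p ≠ 0)]
    · rw [mul_assoc, ← abs_mul_abs_self s, ← mul_assoc, ← Real.rpow_add_one (abs_ne_zero.2 hs),
        ← Real.rpow_add_one (abs_ne_zero.2 hs)]
      congr 1; ring
  -- The conjugate exponent turns the factor paired with `V` into exactly the Hardy weight times `U
  -- ^ p`.
  have e2 : (γ * (|s| ^ (p - 1) * d ^ (1 - p) * U ^ (p - 1))) ^ (p / (p - 1)) =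
      γ ^ (p / (p - 1)) * (|s| ^ p / d ^ p * U ^ p) := by
    rw [Real.mul_rpow hγ (by positivity), Real.mul_rpow (by positivity) (by positivity),
      Real.mul_rpow (by positivity) (by positivity), ← Real.rpow_mul (abs_nonneg s),
      ← Real.rpow_mul hd.le, ← Real.rpow_mul hU]
    rw [show (p - 1) * (p / (p - 1)) = p by field_simp,
      show (1 - p) * (p / (p - 1)) = -p by field_simp; ring, Real.rpow_neg hd.le]
    ring
  have hy := young_mul_le hp hV
    (by positivity : 0 ≤ γ * (|s| ^ (p - 1) * d ^ (1 - p) * U ^ (p - 1)))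
  rw [e2] at hy
  rw [← abs_mul, e0] at hY'
  have hY2 := (le_abs_self _).trans hY'
  have hdp : 0 ≤ d ^ (1 - p) := by positivity
  have hfin := mul_le_mul_of_nonneg_left hY2 (mul_nonneg hγ hdp)
  rw [div_eq_mul_inv (|s| ^ p), ← Real.rpow_neg hd.le] at hy ⊢
  have e3 : γ * (|s| ^ (p - 2) * s * (d ^ (1 - p) * Y - (p - 1) * (d ^ (-p) * s * U ^ p))) =
      γ * d ^ (1 - p) * (|s| ^ (p - 2) * s * Y) -
        γ * (p - 1) * ((|s| ^ (p - 2) * s * s) * d ^ (-p) * U ^ p) := by ring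
  rw [e3, e1]
  linarith

section BoundedField

variable {E : Type*} [NormedAddCommGroup E] [InnerProductSpace ℝ E] [FiniteDimensional ℝ E]
  [MeasurableSpace E] [BorelSpace E] {μ : Measure E}

open Classical in
theorem ContinuousOn.aemeasurable_comp_prodMk {Ω : Set E} {ν : E → E} {F : E × E → ℝ}
    (hΩ : IsOpen Ω) (hνm : AEMeasurable ν (μ.restrict Ω)) (hF : ContinuousOn F (Ω ×ˢ univ)) :
    AEMeasurable (fun x => F (x, ν x)) (μ.restrict Ω) := by
  have hS : MeasurableSet (Ω ×ˢ (univ : Set E)) := hΩ.measurableSet.prod MeasurableSet.univ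
  have h1 : Measurable ((Ω ×ˢ (univ : Set E)).piecewise F 0) :=
    hF.measurable_piecewise continuousOn_const hS
  refine (h1.comp_aemeasurable (aemeasurable_id.prodMk hνm)).congr ?_
  filter_upwards [ae_restrict_mem hΩ.measurableSet] with x hx
  simp [hx]

/-- The integrands are continuous in `(x, ν x)` over `Ω`. As `ν` is bounded there, they are bounded
on a compact set outside which they vanish, although `ν` itself is only measurable. -/
theorem ContinuousOn.integrableOn_comp_prodMk [IsFiniteMeasureOnCompacts μ] {Ω K : Set E} {ν : E → E} {F : E × E → ℝ}
    (hΩ : IsOpen Ω) (hK : IsCompact K) (hKΩ : K ⊆ Ω) (hνm : AEMeasurable ν (μ.restrict Ω))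
    (hν1 : ∀ x ∈ Ω, ‖ν x‖ ≤ 1) (hF : ContinuousOn F (Ω ×ˢ univ))
    (hF0 : ∀ x, x ∉ K → F (x, ν x) = 0) : IntegrableOn (fun x => F (x, ν x)) Ω μ := by
  obtain ⟨C, hC⟩ := (hK.prod (isCompact_closedBall (0 : E) 1)).exists_bound_of_continuousOn
    (hF.mono (prod_mono hKΩ (subset_univ _)))
  have hKi : Integrable (K.indicator fun _ => C) (μ.restrict Ω) :=
    ((integrable_indicator_iff hK.measurableSet).2
      (integrableOn_const hK.measure_lt_top.ne)).mono_measure Measure.restrict_le_self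
  refine hKi.mono' (ContinuousOn.aemeasurable_comp_prodMk hΩ hνm hF).aestronglyMeasurable
    (Eventually.of_forall fun x => ?_)
  by_cases hx : x ∈ K
  · rw [indicator_of_mem hx]
    exact hC (x, ν x) ⟨hx, by simpa using hν1 x (hKΩ hx)⟩
  · rw [indicator_of_notMem hx, hF0 x hx, norm_zero]

end BoundedField

/-- On the compact support `d` has a positive lower bound `c`, so `d` may be replaced by `max d c`,
whose negative powers are bounded and Lipschitz. -/
theorem exists_lipschitzWith_rpow_mul {α : Type*} [PseudoMetricSpace α] {d φ : α → ℝ}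
    {Ld Lφ : NNReal} {a : ℝ} (hd : LipschitzWith Ld d) (hφ : LipschitzWith Lφ φ)
    (hφc : HasCompactSupport φ) (hpos : ∀ x ∈ tsupport φ, 0 < d x) (ha : a ≤ 0) :
    ∃ L : NNReal, LipschitzWith L (fun x => d x ^ a * φ x) := by
  obtain ⟨c, hc, hcd⟩ := IsCompact.exists_forall_le' hφc hd.continuous.continuousOn hpos
  obtain ⟨Lr, hLr⟩ := lipschitzWith_max_rpow hc ha
  obtain ⟨B, hB⟩ := hφc.exists_bound_of_continuous hφ.continuous
  have heq : (fun x => d x ^ a * φ x) = fun x => max (d x) c ^ a * φ x := by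
    ext x
    by_cases hx : x ∈ tsupport φ
    · rw [max_eq_left (hcd x hx)]
    · rw [image_eq_zero_of_notMem_tsupport hx, mul_zero, mul_zero]
  rw [heq]
  refine (hLr.comp hd).mul_of_bounded hφ (A := c ^ a) (fun x => ?_) hB
  have h1 : c ≤ max (d x) c := le_max_right _ _
  rw [abs_of_nonneg (Real.rpow_nonneg (hc.le.trans h1) _)]
  exact Real.rpow_le_rpow_of_nonpos hc h1 ha

theorem abs_fderiv_norm_rpow_apply_le {E F : Type*} [NormedAddCommGroup E] [NormedSpace ℝ E]
    [NormedAddCommGroup F] [InnerProductSpace ℝ F] {f : E → F} (hf : Differentiable ℝ f) {p : ℝ}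
    (hp : 1 < p) (x v : E) :
    |fderiv ℝ (fun x => ‖f x‖ ^ p) x v| ≤ p * ‖f x‖ ^ (p - 1) * ‖fderiv ℝ f x v‖ := by
  rw [hf.fderiv_norm_rpow hp]
  simp only [smul_apply, ContinuousLinearMap.comp_apply, innerSL_apply_apply, smul_eq_mul]
  rw [abs_mul, abs_of_nonneg (by positivity)]
  have h1 := abs_real_inner_le_norm (f x) (fderiv ℝ f x v)
  have h2 : ‖f x‖ ^ (p - 1) = ‖f x‖ ^ (p - 2) * ‖f x‖ := by
    rw [← Real.rpow_add_one' (norm_nonneg _) (by linarith)]; congr 1; ring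
  rw [h2]
  calc _ ≤ p * ‖f x‖ ^ (p - 2) * (‖f x‖ * ‖fderiv ℝ f x v‖) := by gcongr
    _ = _ := by ring

theorem fderiv_rpow_mul_apply {E : Type*} [NormedAddCommGroup E] [NormedSpace ℝ E] {d φ : E → ℝ}
    {x : E} (hd : DifferentiableAt ℝ d x) (hφ : DifferentiableAt ℝ φ x) (hx : 0 < d x) (a : ℝ)
    (v : E) : fderiv ℝ (fun x => d x ^ a * φ x) x v =
      d x ^ a * fderiv ℝ φ x v + a * d x ^ (a - 1) * fderiv ℝ d x v * φ x := by
  have h1 := (hd.hasFDerivAt.rpow_const (p := a) (Or.inl hx.ne')).mul hφ.hasFDerivAt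
  refine (congrArg (fun L : E →L[ℝ] ℝ => L v) (HasFDerivAt.fderiv h1)).trans ?_
  simp only [add_apply, smul_apply, smul_eq_mul]
  ring

namespace StratifiedGroup

variable {𝕜 : Type*} [RCLike 𝕜] {n : ℕ} (G : StratifiedGroup n)
  {Ω : Set (EuclideanSpace ℝ (Fin n))} {ν : EuclideanSpace ℝ (Fin n) → EuclideanSpace ℝ (Fin n)}

theorem hardyTerm_eq {p : ℝ} (u : EuclideanSpace ℝ (Fin n) → 𝕜) (i : G.Horizontal)
    {x : EuclideanSpace ℝ (Fin n)} (hx : 0 < infDist x (frontier Ω)) :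
    G.hardyTerm Ω ν p u i x = |inner ℝ (G.X i x) (ν x)| ^ (p - 2) *
      (infDist x (frontier Ω) ^ (1 - p) *
        inner ℝ (fderiv ℝ (G.X i) x (G.X i x)) (ν x) * ‖u x‖ ^ p) := by
  rw [hardyTerm, normalDeriv_eq, Real.div_rpow (abs_nonneg _) hx.le,
    show (1 - p) = -(p - 2) - 1 by ring, Real.rpow_sub_one hx.ne', Real.rpow_neg hx.le]
  ring

theorem integral_deriv_inner_X_nonneg (hΩ : IsOpen Ω)
    (hν : IsNormalMap Ω ν) (hνm : AEMeasurable ν (volume.restrict Ω)) (i : G.Horizontal)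
    {ψ : EuclideanSpace ℝ (Fin n) → ℝ} {L : NNReal} (hψ : LipschitzWith L ψ)
    (hψc : HasCompactSupport ψ) (hψΩ : tsupport ψ ⊆ Ω) (hψ0 : ∀ x, 0 ≤ ψ x)
    {h : ℝ → ℝ} (hh : ContDiff ℝ 1 h) (hhm : Monotone h) :
    0 ≤ ∫ x in Ω, deriv h (inner ℝ (G.X i x) (ν x)) *
        inner ℝ (fderiv ℝ (G.X i) x (G.X i x)) (ν x) * ψ x +
      h (inner ℝ (G.X i x) (ν x)) * fderiv ℝ ψ x (G.X i x) := by
  have hν1 : ∀ x ∈ Ω, Ω.indicator ν x = ν x := fun x hx => indicator_of_mem hx _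
  have hE : ContDiff ℝ ∞
      (fun q : ℝ × EuclideanSpace ℝ (Fin n) => q.1 • EuclideanSpace.single i.1 (1 : ℝ)) :=
    contDiff_fst.smul contDiff_const
  have hΦ : ContDiff ℝ ∞ (Function.uncurry fun (t : ℝ) (x : EuclideanSpace ℝ (Fin n)) =>
      G.op x (t • EuclideanSpace.single i.1 1)) :=
    G.contDiff_op.comp (contDiff_snd.prodMk hE)
  have hΨ : ContDiff ℝ ∞ (Function.uncurry fun (t : ℝ) (x : EuclideanSpace ℝ (Fin n)) =>
      G.op x (G.inv (t • EuclideanSpace.single i.1 1))) :=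
    G.contDiff_op.comp (contDiff_snd.prodMk (G.contDiff_inv.comp hE))
  have hinv0 : G.inv 0 = 0 := by rw [← G.op_zero (G.inv 0), G.inv_op]
  -- The deformation is `x ↦ x ∘ (t e_i)`, undone by right translation by the group inverse. It need
  -- not be the flow of `X_i`: only its velocity at `t = 0` enters.
  have key := integral_deriv_angle_nonneg (μ := volume) (ν := Ω.indicator ν) (X := G.X i) hΩ
    (contDiff_infty.1 hΦ 2) (fun x => by rw [zero_smul, G.op_zero])
    ((G.contDiff_X i).of_le (by simp)) (G.hasDerivAt_op_smul i) hΨ.continuous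
    (fun x => by rw [zero_smul, hinv0, G.op_zero])
    (fun t x => by rw [G.op_assoc, G.op_inv, G.op_zero])
    (fun t => G.measurePreserving_op_left _)
    -- Adding the supergradient inequalities at `x` and at `z` gives the monotonicity of `-ν`.
    (fun x hx z hz => by
      rw [hν1 x hx, hν1 z hz]
      have h1 := hν.infDist_le hΩ hx hz
      have h2 := hν.infDist_le hΩ hz hx
      rw [← neg_sub z x, inner_neg_left] at h2
      rw [inner_sub_right]; linarith)
    (fun x => by
      by_cases hx : x ∈ Ω
      · rw [hν1 x hx, hν.norm_eq_one hx]
      · rw [indicator_of_notMem hx, norm_zero]; exact zero_le_one)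
    ((aemeasurable_indicator_iff hΩ.measurableSet).2 hνm)
    (by
      filter_upwards [(lipschitz_infDist_pt (frontier Ω)).ae_differentiableAt (μ := volume)]
        with x hxd hx
      exact (continuousWithinAt_of_supergradient hΩ (fun x hx z hz => hν.infDist_le hΩ hx hz)
        (fun x hx => (hν.norm_eq_one hx).le) hx hxd).congr (fun y hy => hν1 y hy) (hν1 x hx))
    hψ hψc hψΩ hψ0 hh hhm
  rw [← setIntegral_eq_integral_of_forall_compl_eq_zero (s := Ω)] at key
  · refine key.trans_eq (setIntegral_congr_fun hΩ.measurableSet fun x hx => ?_)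
    simp only [hν1 x hx]
  · intro x hx
    have h1 : fderiv ℝ ψ x = 0 := image_eq_zero_of_notMem_tsupport
      fun h' => hx (hψΩ (tsupport_fderiv_subset ℝ h'))
    rw [image_eq_zero_of_notMem_tsupport fun h' => hx (hψΩ h'), h1]
    simp

end StratifiedGroup

/-! ### The inequality for one horizontal field, and summation -/

namespace StratifiedGroup

variable {𝕜 : Type*} [RCLike 𝕜] {n : ℕ} (G : StratifiedGroup n)
  {Ω : Set (EuclideanSpace ℝ (Fin n))} {ν : EuclideanSpace ℝ (Fin n) → EuclideanSpace ℝ (Fin n)}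

theorem continuous_inner_X (i : G.Horizontal) :
    Continuous fun q : EuclideanSpace ℝ (Fin n) × EuclideanSpace ℝ (Fin n) =>
      (inner ℝ (G.X i q.1) q.2 : ℝ) :=
  ((G.contDiff_X i).continuous.comp continuous_fst).inner continuous_snd

theorem continuous_inner_fderiv_X (i : G.Horizontal) :
    Continuous fun q : EuclideanSpace ℝ (Fin n) × EuclideanSpace ℝ (Fin n) =>
      (inner ℝ (fderiv ℝ (G.X i) q.1 (G.X i q.1)) q.2 : ℝ) := by
  have h : Continuous fun x => fderiv ℝ (G.X i) x (G.X i x) :=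
    ((G.contDiff_X i).continuous_fderiv (by simp)).clm_apply (G.contDiff_X i).continuous
  exact (h.comp continuous_fst).inner continuous_snd

theorem continuousOn_infDist_rpow (hΩ : IsOpen Ω) (hne : Ω ≠ univ) (a : ℝ) :
    ContinuousOn (fun q : EuclideanSpace ℝ (Fin n) × EuclideanSpace ℝ (Fin n) =>
      infDist q.1 (frontier Ω) ^ a) (Ω ×ˢ univ) :=
  ((continuous_infDist_pt _).comp continuous_fst).continuousOn.rpow_const fun _ hq =>
    Or.inl (infDist_frontier_pos hΩ hne hq.1).ne'

theorem continuous_norm_rpow_fst {u : EuclideanSpace ℝ (Fin n) → 𝕜} (hu : Continuous u) {p : ℝ}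
    (hp : 0 ≤ p) : Continuous fun q : EuclideanSpace ℝ (Fin n) × EuclideanSpace ℝ (Fin n) =>
      ‖u q.1‖ ^ p :=
  (hu.comp continuous_fst).norm.rpow_const fun _ => Or.inr hp

theorem continuous_XDeriv (i : G.Horizontal) {F : Type*} [NormedAddCommGroup F] [NormedSpace ℝ F]
    {u : EuclideanSpace ℝ (Fin n) → F} (hu : ContDiff ℝ 1 u) : Continuous (G.XDeriv i u) :=
  (hu.continuous_fderiv one_ne_zero).clm_apply (G.contDiff_X i).continuous

theorem XDeriv_of_notMem_tsupport (i : G.Horizontal) {F : Type*} [NormedAddCommGroup F]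
    [NormedSpace ℝ F] {u : EuclideanSpace ℝ (Fin n) → F} {x : EuclideanSpace ℝ (Fin n)}
    (hx : x ∉ tsupport u) : G.XDeriv i u x = 0 := by
  have h1 : fderiv ℝ u x = 0 := image_eq_zero_of_notMem_tsupport
    fun h' => hx (tsupport_fderiv_subset ℝ h')
  rw [XDeriv, h1, zero_apply]

theorem integrable_norm_XDeriv_rpow (i : G.Horizontal) {u : EuclideanSpace ℝ (Fin n) → 𝕜}
    (hu : ContDiff ℝ 1 u) (hu_comp : HasCompactSupport u) {p : ℝ} (hp : 0 < p) :
    Integrable (fun x => ‖G.XDeriv i u x‖ ^ p) := by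
  refine Continuous.integrable_of_hasCompactSupport
    ((G.continuous_XDeriv i hu).norm.rpow_const fun _ => Or.inr hp.le)
    (HasCompactSupport.intro hu_comp fun x hx => ?_)
  rw [G.XDeriv_of_notMem_tsupport i hx, norm_zero, Real.zero_rpow hp.ne']

theorem integrableOn_angle_term (hΩ : IsOpen Ω) (hne : Ω ≠ univ) (hν : IsNormalMap Ω ν)
    (hνm : AEMeasurable ν (volume.restrict Ω)) (i : G.Horizontal)
    {u : EuclideanSpace ℝ (Fin n) → 𝕜} (hu : Continuous u) (hu_comp : HasCompactSupport u)
    (hu_supp : tsupport u ⊆ Ω) {p : ℝ} (hp : 0 < p) :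
    IntegrableOn (fun x => |inner ℝ (G.X i x) (ν x)| ^ p / infDist x (frontier Ω) ^ p *
      ‖u x‖ ^ p) Ω := by
  refine ContinuousOn.integrableOn_comp_prodMk (F := fun q =>
    |inner ℝ (G.X i q.1) q.2| ^ p / infDist q.1 (frontier Ω) ^ p * ‖u q.1‖ ^ p) hΩ hu_comp hu_supp
    hνm (fun x hx => (hν.norm_eq_one hx).le) ?_ fun x hx => ?_
  · exact (((G.continuous_inner_X i).abs.rpow_const fun _ => Or.inr hp.le).continuousOn.div
      (continuousOn_infDist_rpow hΩ hne p) fun q hq =>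
        (Real.rpow_pos_of_pos (infDist_frontier_pos hΩ hne hq.1) _).ne').mul
      (continuous_norm_rpow_fst hu hp.le).continuousOn
  · simp [image_eq_zero_of_notMem_tsupport hx, Real.zero_rpow hp.ne']

theorem integrableOn_hardyTerm (hΩ : IsOpen Ω) (hne : Ω ≠ univ) (hν : IsNormalMap Ω ν)
    (hνm : AEMeasurable ν (volume.restrict Ω)) (i : G.Horizontal)
    {u : EuclideanSpace ℝ (Fin n) → 𝕜} (hu : Continuous u) (hu_comp : HasCompactSupport u)
    (hu_supp : tsupport u ⊆ Ω) {p : ℝ} (hp : 2 ≤ p) :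
    IntegrableOn (G.hardyTerm Ω ν p u i) Ω := by
  have hp0 : p ≠ 0 := by linarith
  have h := ContinuousOn.integrableOn_comp_prodMk (μ := volume) (ν := ν) (F := fun q =>
    |inner ℝ (G.X i q.1) q.2| ^ (p - 2) * (infDist q.1 (frontier Ω) ^ (1 - p) *
      inner ℝ (fderiv ℝ (G.X i) q.1 (G.X i q.1)) q.2 * ‖u q.1‖ ^ p)) hΩ hu_comp hu_supp
    hνm (fun x hx => (hν.norm_eq_one hx).le) ?_ fun x hx => ?_
  · exact h.congr_fun (fun x hx => (G.hardyTerm_eq u i (infDist_frontier_pos hΩ hne hx)).symm)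
      hΩ.measurableSet
  · exact ((G.continuous_inner_X i).abs.rpow_const fun _ => Or.inr (by linarith)).continuousOn.mul
      (((continuousOn_infDist_rpow hΩ hne _).mul (G.continuous_inner_fderiv_X i).continuousOn).mul
        (continuous_norm_rpow_fst hu (by linarith)).continuousOn)
  · simp [image_eq_zero_of_notMem_tsupport hx, Real.zero_rpow hp0]

/-- The weighted Hardy inequality for a single horizontal field. -/
theorem integral_norm_XDeriv_rpow_ge (hΩ : IsOpen Ω) (hne : Ω ≠ univ) (hν : IsNormalMap Ω ν)
    (hνm : AEMeasurable ν (volume.restrict Ω)) (i : G.Horizontal)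
    {u : EuclideanSpace ℝ (Fin n) → 𝕜} (hu : ContDiff ℝ 1 u) (hu_comp : HasCompactSupport u)
    (hu_supp : tsupport u ⊆ Ω) {p β : ℝ} (hp : 1 < p) (hβ : β < 0)
    (hT : IntegrableOn (fun x => max (G.hardyTerm Ω ν p u i x) 0) Ω) :
    IntegrableOn (G.hardyTerm Ω ν p u i) Ω ∧
      -(p - 1) * (|β| ^ (p / (p - 1)) + β) *
          (∫ x in Ω, |inner ℝ (G.X i x) (ν x)| ^ p / infDist x (frontier Ω) ^ p * ‖u x‖ ^ p) +
        β * (p - 1) * ∫ x in Ω, G.hardyTerm Ω ν p u i x ≤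
      ∫ x in Ω, ‖G.XDeriv i u x‖ ^ p := by
  have hp0 : 0 < p := by linarith
  have hp1 : 0 < p - 1 := by linarith
  have hd : ∀ x ∈ Ω, 0 < infDist x (frontier Ω) := fun x hx => infDist_frontier_pos hΩ hne hx
  have hν1 : ∀ x ∈ Ω, ‖ν x‖ ≤ 1 := fun x hx => (hν.norm_eq_one hx).le
  set d : EuclideanSpace ℝ (Fin n) → ℝ := fun x => infDist x (frontier Ω) with hd_def
  set φ : EuclideanSpace ℝ (Fin n) → ℝ := fun x => ‖u x‖ ^ p with hφ_def
  set s : EuclideanSpace ℝ (Fin n) → ℝ := fun x => inner ℝ (G.X i x) (ν x) with hs_def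
  -- With the test function `ψ = d ^ (1 - p) φ`, `g` is `⟨(DX) X, ν⟩ ψ` and `e` is almost everywhere
  -- on `Ω` the derivative `Xψ`, computed from `X d = s`. As defined, `e` is a continuous expression
  -- in `(x, ν x)` on `Ω`.
  set g : EuclideanSpace ℝ (Fin n) → ℝ := fun x =>
    d x ^ (1 - p) * inner ℝ (fderiv ℝ (G.X i) x (G.X i x)) (ν x) * φ x with hg_def
  set e : EuclideanSpace ℝ (Fin n) → ℝ := fun x =>
    d x ^ (1 - p) * G.XDeriv i φ x - (p - 1) * (d x ^ (-p) * s x * φ x) with he_def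
  have hφ1 : ContDiff ℝ 1 φ := hu.norm_rpow hp
  have hφ_zero : ∀ x, x ∉ tsupport u → φ x = 0 := fun x hx => by
    simp [hφ_def, image_eq_zero_of_notMem_tsupport hx, Real.zero_rpow hp0.ne']
  have hφu : tsupport φ ⊆ tsupport u := closure_minimal
    (fun x hx => by by_contra h; exact hx (hφ_zero x h)) (isClosed_tsupport u)
  have hφc : HasCompactSupport φ := HasCompactSupport.intro hu_comp hφ_zero
  have hY_zero : ∀ x, x ∉ tsupport u → G.XDeriv i φ x = 0 := fun x hx =>
    G.XDeriv_of_notMem_tsupport i fun h => hx (hφu h)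
  have hφ0 : ∀ x, 0 ≤ φ x := fun x => Real.rpow_nonneg (norm_nonneg _) _
  have hdL : LipschitzWith 1 d := lipschitz_infDist_pt _
  obtain ⟨Lφ, hLφ⟩ := hφ1.lipschitzWith_of_hasCompactSupport hφc one_ne_zero
  obtain ⟨L, hL⟩ := exists_lipschitzWith_rpow_mul (a := 1 - p) hdL hLφ hφc
    (fun x hx => hd x (hu_supp (hφu hx))) (by linarith)
  have hψ_zero : ∀ x, x ∉ tsupport u → d x ^ (1 - p) * φ x = 0 := fun x hx => by
    rw [hφ_zero x hx, mul_zero]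
  have hψu : tsupport (fun x => d x ^ (1 - p) * φ x) ⊆ tsupport u := closure_minimal
    (fun x hx => by by_contra h; exact hx (hψ_zero x h)) (isClosed_tsupport u)
  have hψc : HasCompactSupport fun x => d x ^ (1 - p) * φ x :=
    HasCompactSupport.intro hu_comp hψ_zero
  have hT_eq : EqOn (G.hardyTerm Ω ν p u i) (fun x => |s x| ^ (p - 2) * g x) Ω := fun x hx =>
    G.hardyTerm_eq u i (hd x hx)
  have cs := G.continuous_inner_X i
  have cd := fun a => (continuousOn_infDist_rpow (n := n) hΩ hne a)
  have cφ := continuous_norm_rpow_fst (n := n) hu.continuous hp0.le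
  have ce : ContinuousOn (fun q : EuclideanSpace ℝ (Fin n) × EuclideanSpace ℝ (Fin n) =>
      infDist q.1 (frontier Ω) ^ (1 - p) * G.XDeriv i φ q.1 -
        (p - 1) * (infDist q.1 (frontier Ω) ^ (-p) * inner ℝ (G.X i q.1) q.2 * ‖u q.1‖ ^ p))
      (Ω ×ˢ univ) :=
    ((cd _).mul ((G.continuous_XDeriv i hφ1).comp continuous_fst).continuousOn).sub
      (continuousOn_const.mul (((cd _).mul cs.continuousOn).mul cφ.continuousOn))
  have he_zero : ∀ x, x ∉ tsupport u → e x = 0 := fun x hx => by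
    simp only [he_def]; rw [hY_zero x hx, hφ_zero x hx]; simp
  obtain ⟨h, hh, hhm, hd0, hdC, hhb, hdlim, hhlim⟩ := exists_seq_tendsto_abs_rpow_mul_self hp
  have hs_meas : AEMeasurable s (volume.restrict Ω) :=
    ContinuousOn.aemeasurable_comp_prodMk hΩ hνm cs.continuousOn
  have he_meas : AEMeasurable e (volume.restrict Ω) :=
    ContinuousOn.aemeasurable_comp_prodMk hΩ hνm ce
  have hai : ∀ k, Integrable (fun x => deriv (h k) (s x) * g x) (volume.restrict Ω) := fun k =>
    ContinuousOn.integrableOn_comp_prodMk (F := fun q => deriv (h k) (inner ℝ (G.X i q.1) q.2) *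
      (infDist q.1 (frontier Ω) ^ (1 - p) *
        inner ℝ (fderiv ℝ (G.X i) q.1 (G.X i q.1)) q.2 * ‖u q.1‖ ^ p)) hΩ hu_comp hu_supp hνm hν1
      ((((hh k).continuous_deriv le_rfl).comp cs).continuousOn.mul
        (((cd _).mul (G.continuous_inner_fderiv_X i).continuousOn).mul cφ.continuousOn))
      fun x hx => by
        have := hφ_zero x hx
        simp only [hφ_def] at this
        simp only [this, mul_zero]
  have hei : Integrable (fun x => |s x| ^ (p - 1) * |e x|) (volume.restrict Ω) :=
    ContinuousOn.integrableOn_comp_prodMk (F := fun q => |inner ℝ (G.X i q.1) q.2| ^ (p - 1) *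
      |infDist q.1 (frontier Ω) ^ (1 - p) * G.XDeriv i φ q.1 -
        (p - 1) * (infDist q.1 (frontier Ω) ^ (-p) * inner ℝ (G.X i q.1) q.2 * ‖u q.1‖ ^ p)|)
      hΩ hu_comp hu_supp hνm hν1
      ((cs.abs.rpow_const fun _ => Or.inr hp1.le).continuousOn.mul ce.abs)
      fun x hx => by
        have := he_zero x hx
        simp only [he_def] at this
        exact mul_eq_zero_of_right _ (abs_eq_zero.2 this)
  have hnonneg : ∀ k, 0 ≤ ∫ x in Ω, deriv (h k) (s x) * g x + h k (s x) * e x := fun k => by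
    refine (G.integral_deriv_inner_X_nonneg hΩ hν hνm i hL hψc (hψu.trans hu_supp)
      (fun x => mul_nonneg (Real.rpow_nonneg infDist_nonneg _) (hφ0 x)) (hh k) (hhm k)).trans_eq
      (integral_congr_ae ?_)
    filter_upwards [ae_restrict_of_ae (hdL.ae_differentiableAt (μ := volume)),
      ae_restrict_mem hΩ.measurableSet] with x hxd hx
    have h1 : fderiv ℝ d x (G.X i x) = s x := fderiv_eq_inner_of_supergradient hΩ
      (fun x hx z hz => hν.infDist_le hΩ hx hz) hx hxd _
    have h2 := fderiv_rpow_mul_apply hxd (hφ1.differentiable one_ne_zero x) (hd x hx) (1 - p)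
      (G.X i x)
    rw [h1, show 1 - p - 1 = -p by ring] at h2
    rw [h2]
    simp only [hg_def, he_def, XDeriv, hs_def]
    ring
  have hTpos : Integrable (fun x => max (|s x| ^ (p - 2) * g x) 0) (volume.restrict Ω) :=
    hT.congr_fun (fun x hx => by simp only [hT_eq hx]) hΩ.measurableSet
  obtain ⟨hTi, hmain⟩ := integrable_and_integral_nonneg_of_approx hp
    (fun k => (hh k).continuous) hd0 hdC hhb hdlim hhlim hs_meas he_meas hai hei hTpos hnonneg
  have hT_int : ∫ x in Ω, G.hardyTerm Ω ν p u i x = ∫ x in Ω, |s x| ^ (p - 2) * g x :=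
    setIntegral_congr_fun hΩ.measurableSet hT_eq
  refine ⟨IntegrableOn.congr_fun hTi hT_eq.symm hΩ.measurableSet, ?_⟩
  have hwi := G.integrableOn_angle_term hΩ hne hν hνm i hu.continuous hu_comp hu_supp hp0
  have hVi := (G.integrable_norm_XDeriv_rpow i hu hu_comp hp0).integrableOn (s := Ω)
  have hbi : Integrable (fun x => |s x| ^ (p - 2) * s x * e x) (volume.restrict Ω) := by
    refine hei.mono' ?_ (Eventually.of_forall fun x => ?_)
    · exact (((hs_meas.abs.pow_const _).mul hs_meas).mul he_meas).aestronglyMeasurable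
    · rw [norm_mul, Real.norm_eq_abs (e x)]
      refine mul_le_mul_of_nonneg_right ?_ (abs_nonneg _)
      by_cases h0 : s x = 0
      · rw [h0, mul_zero, norm_zero]; positivity
      · rw [norm_mul, Real.norm_of_nonneg (by positivity), Real.norm_eq_abs,
          ← Real.rpow_add_one (abs_ne_zero.2 h0)]
        exact le_of_eq (by congr 1; ring)
  -- Young's inequality is integrated with `γ = -β`, which equals `|β|`; this gives the coefficient
  -- `(p - 1) (|β| ^ (p / (p - 1)) + β)`.
  have hpt := setIntegral_mono_on (hbi.const_mul (-β))
    (hVi.add (hwi.const_mul ((p - 1) * ((-β) ^ (p / (p - 1)) - -β)))) hΩ.measurableSet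
    fun x hx => mul_abs_rpow_mul_le hp (neg_nonneg.2 hβ.le) (hd x hx) (norm_nonneg (u x))
      (norm_nonneg (G.XDeriv i u x))
      (abs_fderiv_norm_rpow_apply_le (hu.differentiable one_ne_zero) hp x (G.X i x))
  rw [integral_const_mul, integral_add' hVi (hwi.const_mul _), integral_const_mul] at hpt
  have hfin := mul_nonneg (neg_nonneg.2 hβ.le) hmain
  rw [hT_int, abs_of_neg hβ]
  linarith

theorem angleFun_rpow {p : ℝ} (hp : 0 < p) (v x : EuclideanSpace ℝ (Fin n)) :
    G.angleFun p v x ^ p = ∑ i : G.Horizontal, |inner ℝ (G.X i x) v| ^ p := by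
  rw [angleFun, ← Real.rpow_mul (Finset.sum_nonneg fun _ _ => by positivity),
    one_div_mul_cancel hp.ne', Real.rpow_one]

end StratifiedGroup

theorem theorem3p2 {𝕜 : Type*} [RCLike 𝕜] {n : ℕ} (G : StratifiedGroup n)
    (Ω : Set (EuclideanSpace ℝ (Fin n))) (hΩ_open : IsOpen Ω) (hΩ_conv : Convex ℝ Ω)
    (hΩ_ne : Ω.Nonempty) (hΩ_univ : Ω ≠ Set.univ)
    (ν : EuclideanSpace ℝ (Fin n) → EuclideanSpace ℝ (Fin n)) (hν : IsNormalMap Ω ν)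
    (p β : ℝ) (hp : 1 < p) (hβ : β < 0)
    (u : EuclideanSpace ℝ (Fin n) → 𝕜) (hu : ContDiff ℝ ∞ u)
    (hu_comp : HasCompactSupport u) (hu_supp : tsupport u ⊆ Ω) :
    MeasureTheory.IntegrableOn (fun x => ∑ i, ‖G.XDeriv i u x‖ ^ p) Ω ∧
    MeasureTheory.IntegrableOn
      (fun x => G.angleFun p (ν x) x ^ p / Metric.infDist x (frontier Ω) ^ p * ‖u x‖ ^ p) Ω ∧
    (2 ≤ p → ∀ i, MeasureTheory.IntegrableOn (G.hardyTerm Ω ν p u i) Ω) ∧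
    ((∀ i, MeasureTheory.IntegrableOn (fun x => max (G.hardyTerm Ω ν p u i x) 0) Ω) →
      (∀ i, MeasureTheory.IntegrableOn (G.hardyTerm Ω ν p u i) Ω) ∧
      ∫ x in Ω, ∑ i, ‖G.XDeriv i u x‖ ^ p ≥
        -(p - 1) * (|β| ^ (p / (p - 1)) + β) *
            (∫ x in Ω, G.angleFun p (ν x) x ^ p / Metric.infDist x (frontier Ω) ^ p * ‖u x‖ ^ p) +
          β * (p - 1) * ∫ x in Ω, ∑ i, G.hardyTerm Ω ν p u i x) := by
  have hp0 : 0 < p := by linarith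
  have hu1 : ContDiff ℝ 1 u := hu.of_le (by simp)
  have hνm : AEMeasurable ν (volume.restrict Ω) := aemeasurable_of_supergradient hΩ_open
    (fun x hx z hz => hν.infDist_le hΩ_open hx hz)
    (lipschitz_infDist_pt (frontier Ω)).ae_differentiableAt
  have hVi := fun i => (G.integrable_norm_XDeriv_rpow i hu1 hu_comp hp0).integrableOn (s := Ω)
  have hwi := fun i => G.integrableOn_angle_term hΩ_open hΩ_univ hν hνm i hu.continuous hu_comp
    hu_supp hp0
  have hw : (fun x => G.angleFun p (ν x) x ^ p / infDist x (frontier Ω) ^ p * ‖u x‖ ^ p) =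
      fun x => ∑ i : G.Horizontal,
        |inner ℝ (G.X i x) (ν x)| ^ p / infDist x (frontier Ω) ^ p * ‖u x‖ ^ p := by
    ext x
    rw [G.angleFun_rpow hp0, Finset.sum_div, Finset.sum_mul]
  refine ⟨integrable_finsetSum _ fun i _ => hVi i, ?_, fun hp2 i =>
    G.integrableOn_hardyTerm hΩ_open hΩ_univ hν hνm i hu.continuous hu_comp hu_supp hp2,
    fun hT => ?_⟩
  · rw [hw]
    exact integrable_finsetSum _ fun i _ => hwi i
  -- Since `𝒲_p ^ p` is the sum of the `|⟨X_i, ν⟩| ^ p`, both sides split over `i`, and it suffices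
  -- to treat each field alone.
  have key := fun i => G.integral_norm_XDeriv_rpow_ge hΩ_open hΩ_univ hν hνm i hu1 hu_comp hu_supp
    hp hβ (hT i)
  refine ⟨fun i => (key i).1, ?_⟩
  rw [hw, integral_finsetSum _ fun i _ => hVi i, integral_finsetSum _ fun i _ => hwi i,
    integral_finsetSum _ fun i _ => (key i).1, Finset.mul_sum, Finset.mul_sum,
    ← Finset.sum_add_distrib]
  exact Finset.sum_le_sum fun i _ => (key i).2
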